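/- **Correctness of the recursive LDU algorithm.** Let $R$ be a commutative domain with fraction field $F$. *Minors.* Let $\mathcal M\in R^{N\times N}$, let $0\le k\le N$, and let $\alpha$ be the determinant of the upper left $k\times k$ block of $\mathcal M$ ($\alpha=1$ if $k=0$); assume $\alpha\neq 0$. For rows $i_1,\dots,i_m$ and columns $j_1,\dots,j_m$ of $\mathcal M$ let $\Delta(i_1,\dots,i_m;j_1,\dots,j_m)$ be the determinant of the matrix formed by the first $k$ rows of $\mathcal M$ followed by rows $i_1,\dots,i_m$, and the first $k$ columns followed by columns $j_1,\dots,j_m$. Let $n=2^p$, and let $A\in R^{n\times n}$ be a matrix of rank $r$ of minors surrounding $\alpha$: $A_{ij}=\Delta(\rho(i);\gamma(j))$ for a choice of rows $\rho(i)$ and columns $\gamma(j)$ of $\mathcal M$. (For $k=0$ one can take $A=\mathcal M$.) *Notation.* A truncated weighted permutation matrix $D$ is a square matrix over $F$ with at most one nonzero entry in each row and in each column. $D^+$ is its transpose with the nonzero entries inverted; $E=D^{\to1}$ is $D$ with all nonzero entries replaced by $1$; $\mathbf I$ is the unit matrix, $I=EE^T$, $J=E^TE$, $\bar I=\mathbf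 I-I$, $\bar J=\mathbf I-J$. $D^{Ext}$ is obtained from $D$ by replacing the block at the intersection of the zero rows and zero columns by a unit matrix (rows and columns in increasing order), and $\bar D=D^{Ext}-D$. For a scalar $c$ put $I^{c}=cI+\bar I$, $J^{c}=cJ+\bar J$. Indices on $I,J,\bar D,\widehat D$ refer to the matrix $D$ with the same index. *The algorithm* $(L,D,U,M,\widehat D,W,\alpha_r)=\mathbf{LDU}(A,\alpha)$, computed over $F$: 1. If $A=0$: $L=U=\mathbf I$, $D=0$, $M=W=\alpha\mathbf I$, $\widehat D=\alpha^{-1}\mathbf I$, $\alpha_r=\alpha$. 2. If $n=1$, $A=[a]$, $a\ne0$: $L=U=M=W=[a]$, $D=[(\alpha a)^{-1}]$, $\widehat D=[a^{-2}]$, $\alpha_r=a$. 3. Otherwise split $A=\begin{pmatrix}A_{11}&A_{12}\\A_{21}&A_{22}\end{pmatrix}$ into four equal blocks and compute, in this order: - $(L_{11},D_{11},U_{11},M_{11},\widehat D_{11},W_{11},\alpha_k)=\mathbf{LDU}(A_{11},\alpha)$; - $A_{12}^1=\alpha_k\widehat D_{11}M_{11}A_{12}$, $A_{12}^2=\alpha^{-1}\bar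 D_{11}M_{11}A_{12}$, $A_{21}^1=\alpha_kA_{21}W_{11}\widehat D_{11}$, $A_{21}^2=\alpha^{-1}A_{21}W_{11}\bar D_{11}$; - $(L_{21},D_{21},U_{21},M_{21},\widehat D_{21},W_{21},\alpha_l)=\mathbf{LDU}(A_{21}^2,\alpha_k)$ and $(L_{12},D_{12},U_{12},M_{12},\widehat D_{12},W_{12},\alpha_m)=\mathbf{LDU}(A_{12}^2,\alpha_k)$; - $\lambda=\alpha_l/\alpha_k$, $\alpha_s=\lambda\alpha_m$, $A_{22}^1=(\alpha\alpha_k)^{-1}(\alpha\alpha_k^2A_{22}-A_{21}^1D_{11}^+A_{12}^1)$, $A_{22}^3=(\alpha_k^2\alpha)^{-1}\bar D_{21}M_{21}A_{22}^1W_{12}\bar D_{12}$; - $(L_{22},D_{22},U_{22},M_{22},\widehat D_{22},W_{22},\alpha_r)=\mathbf{LDU}(A_{22}^3,\alpha_s)$; - $U_2=\alpha_k^{-1}J_{11}M_{11}A_{12}+(\alpha_l\alpha)^{-1}J_{21}M_{21}A_{22}^1$, $L_3=\alpha_k^{-1}A_{21}W_{11}I_{11}+(\alpha_m\alpha_k\alpha)^{-1}\bar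 D_{21}M_{21}A_{22}^1W_{12}I_{12}$; - $L=\begin{pmatrix}L_{11}L_{12}I_{12}^{\lambda}&0\\L_3&L_{21}L_{22}\end{pmatrix}$, $D=\begin{pmatrix}D_{11}&\lambda^{-2}D_{12}\\D_{21}&D_{22}\end{pmatrix}$, $U=\begin{pmatrix}U_{21}U_{11}&U_2\\0&U_{22}J_{12}^{\lambda}U_{12}\end{pmatrix}$, $\widehat D=\alpha\alpha_r^{-1}D+\alpha_r^{-1}\bar D$; - with $P_1=I_{12}^{\lambda^{-1}}\widehat D_{12}M_{12}\widehat D_{11}M_{11}$, $P_4=\widehat D_{22}M_{22}\widehat D_{21}M_{21}$, $Q_1=W_{11}\widehat D_{11}W_{21}\widehat D_{21}$, $Q_4=W_{12}\widehat D_{12}J_{12}^{\lambda^{-1}}W_{22}\widehat D_{22}$: $M=\widehat D^{-1}\begin{pmatrix}P_1&0\\-P_4L_3P_1&P_4\end{pmatrix}$, $W=\begin{pmatrix}Q_1&-Q_1U_2Q_4\\0&Q_4\end{pmatrix}\widehat D^{-1}$. **Theorem.** The output of $\mathbf{LDU}(A,\alpha)$ satisfies: - $L$ is lower triangular and $U$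 upper triangular, both have entries in $R$; $\alpha M$ and $\alpha W$ have entries in $R$ (so $M$ and $W$ have entries in $R$ when $\alpha=1$); $L,U,M,W$ have rank $n$. - $D$ is a truncated weighted permutation matrix of rank $r$. There are distinct rows $s_1,\dots,s_r$ and distinct columns $t_1,\dots,t_r$ such that the nonzero entries of $D$ are exactly those at the positions $(s_q,t_q)$, and, with $\det_0=\alpha$ and the nested minors $\det_q=\Delta(\rho(s_1),\dots,\rho(s_q);\gamma(t_1),\dots,\gamma(t_q))$ of $\mathcal M$, all $\det_q$ are nonzero and $D_{s_qt_q}=(\det_{q-1}\det_q)^{-1}$ for $q=1,\dots,r$. Moreover $\alpha_r=\det_r$. - $\widehat D=\det_r^{-1}(\alpha D)^{Ext}$, and $\alpha LDU=A$, $L\widehat DM=\mathbf I$, $W\widehat DU=\mathbf I$. - $L\bar I=\bar I$ and $\bar JU=\bar J$. -/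

import Mathlib

namespace LDU

/-! ### Truncated weighted permutation matrices -/

section Perm

variable {F : Type*} [Field F] {n : ℕ}

/-- Truncated weighted permutation matrices: some (possibly all) of the nonzero entries of a
weighted permutation matrix are replaced by zeros. -/
def IsTruncWeightedPerm (D : Matrix (Fin n) (Fin n) F) : Prop :=
  ∃ σ : Equiv.Perm (Fin n), ∀ i j, D i j ≠ 0 → σ i = j

variable [DecidableEq F]

/-- The unit mapping `D ↦ D^{→1}`: nonzero entries are replaced by `1`. -/
def unitMap (D : Matrix (Fin n) (Fin n) F) : Matrix (Fin n) (Fin n) F :=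
  Matrix.of fun i j => if D i j = 0 then 0 else 1

/-- `I = E Eᵀ`, where `E = D^{→1}`. -/
def rowProj (D : Matrix (Fin n) (Fin n) F) : Matrix (Fin n) (Fin n) F :=
  unitMap D * (unitMap D).transpose

/-- `J = Eᵀ E`, where `E = D^{→1}`. -/
def colProj (D : Matrix (Fin n) (Fin n) F) : Matrix (Fin n) (Fin n) F :=
  (unitMap D).transpose * unitMap D

/-- The indices of the zero rows of `D`. -/
def zeroRows (D : Matrix (Fin n) (Fin n) F) : Finset (Fin n) :=
  Finset.univ.filter fun i => D.row i = 0

/-- The indices of the zero columns of `D`. -/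
def zeroCols (D : Matrix (Fin n) (Fin n) F) : Finset (Fin n) :=
  Finset.univ.filter fun j => D.col j = 0

/-- The complementary mapping `D ↦ D̄ = D^Ext - D`: the block at the intersection of the zero rows
and the zero columns of `D` is the unit matrix (the `t`-th zero row meets the `t`-th zero column
in a `1`), all other entries are `0`. -/
def compl (D : Matrix (Fin n) (Fin n) F) : Matrix (Fin n) (Fin n) F :=
  Matrix.of fun i j =>
    if i ∈ zeroRows D ∧ j ∈ zeroCols D ∧
        ((zeroRows D).filter (· < i)).card = ((zeroCols D).filter (· < j)).card
    then 1 else 0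

/-- The extended mapping `D ↦ D^Ext`: the block at the intersection of the zero rows and the zero
columns of `D` is replaced by the unit block. -/
def ext (D : Matrix (Fin n) (Fin n) F) : Matrix (Fin n) (Fin n) F :=
  D + compl D

end Perm

/-- The generalized inverse `D⁺` of a truncated weighted permutation matrix: transpose and invert
the nonzero entries. -/
def pinv {F : Type*} [Field F] {n : ℕ} (D : Matrix (Fin n) (Fin n) F) : Matrix (Fin n) (Fin n) F :=
  Matrix.of fun i j => (D j i)⁻¹

/-! ### The recursive algorithm -/

/-- The data `(L, D, U, M, D̂, W, α_r)` returned by the algorithm. -/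
structure Output (F : Type*) (n : ℕ) where
  L : Matrix (Fin n) (Fin n) F
  D : Matrix (Fin n) (Fin n) F
  U : Matrix (Fin n) (Fin n) F
  M : Matrix (Fin n) (Fin n) F
  Dhat : Matrix (Fin n) (Fin n) F
  W : Matrix (Fin n) (Fin n) F
  αr : F

/-- Identification of two consecutive index blocks of length `2 ^ p` with `Fin (2 ^ (p + 1))`. -/
def halves (p : ℕ) : Fin (2 ^ p) ⊕ Fin (2 ^ p) ≃ Fin (2 ^ (p + 1)) :=
  finSumFinEquiv.trans (finCongr (by rw [pow_succ, mul_two]))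

/-- The block matrix `(A B; C D)` of size `2 ^ (p + 1)`. -/
def joinBlocks {F : Type*} {p : ℕ} (A B C D : Matrix (Fin (2 ^ p)) (Fin (2 ^ p)) F) :
    Matrix (Fin (2 ^ (p + 1))) (Fin (2 ^ (p + 1))) F :=
  Matrix.reindex (halves p) (halves p) (Matrix.fromBlocks A B C D)

section Algorithm

variable {F : Type*} [Field F] [DecidableEq F]

/-- The output for `A = 0`. -/
def zeroOutput (n : ℕ) (α : F) : Output F n where
  L := 1
  D := 0
  U := 1
  M := α • (1 : Matrix (Fin n) (Fin n) F)
  Dhat := α⁻¹ • (1 : Matrix (Fin n) (Fin n) F)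
  W := α • (1 : Matrix (Fin n) (Fin n) F)
  αr := α

/-- For a diagonal 0-1 matrix `P`: the matrix `P^c = c P + P̄`, where `P̄ = 1 - P`. -/
def weight {n : ℕ} (c : F) (P : Matrix (Fin n) (Fin n) F) : Matrix (Fin n) (Fin n) F :=
  c • P + (1 - P)

/-- The dichotomous recursive procedure `LDU(A, α)` for matrices of size `2 ^ p`. -/
noncomputable def ldu :
    (p : ℕ) → Matrix (Fin (2 ^ p)) (Fin (2 ^ p)) F → F → Output F (2 ^ p)
  | 0, A, α =>
    if A = 0 then zeroOutput (2 ^ 0) α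
    else
      { L := A
        D := Matrix.of fun i j => (α * A i j)⁻¹
        U := A
        M := A
        Dhat := Matrix.of fun i j => ((A i j) ^ 2)⁻¹
        W := A
        αr := A 0 0 }
  | p + 1, A, α =>
    if A = 0 then zeroOutput (2 ^ (p + 1)) α
    else
      let B := Matrix.reindex (halves p).symm (halves p).symm A
      let A₁₁ := B.toBlocks₁₁
      let A₁₂ := B.toBlocks₁₂
      let A₂₁ := B.toBlocks₂₁
      let A₂₂ := B.toBlocks₂₂
      -- first recursive call
      let X₁₁ := ldu p A₁₁ α
      let αk := X₁₁.αr
      let A₁₂_0 := X₁₁.M * A₁₂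
      let A₁₂_1 := αk • (X₁₁.Dhat * A₁₂_0)
      let A₁₂_2 := α⁻¹ • (compl X₁₁.D * A₁₂_0)
      let A₂₁_0 := A₂₁ * X₁₁.W
      let A₂₁_1 := αk • (A₂₁_0 * X₁₁.Dhat)
      let A₂₁_2 := α⁻¹ • (A₂₁_0 * compl X₁₁.D)
      -- second and third recursive calls
      let X₂₁ := ldu p A₂₁_2 αk
      let X₁₂ := ldu p A₁₂_2 αk
      let αl := X₂₁.αr
      let αm := X₁₂.αr
      let lam := αl / αk
      let αs := lam * αm
      let A₂₂_0 := A₂₁_1 * pinv X₁₁.D * A₁₂_1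
      let A₂₂_1 := (α * αk)⁻¹ • ((α * αk ^ 2) • A₂₂ - A₂₂_0)
      let A₂₂_2 := compl X₂₁.D * X₂₁.M * A₂₂_1 * X₁₂.W * compl X₁₂.D
      let A₂₂_3 := (αk ^ 2 * α)⁻¹ • A₂₂_2
      -- fourth recursive call
      let X₂₂ := ldu p A₂₂_3 αs
      let αr := X₂₂.αr
      let L₁₂ := X₁₂.L * weight lam (rowProj X₁₂.D)
      let U₁₂ := weight lam (colProj X₁₂.D) * X₁₂.U
      let U₂ := αk⁻¹ • (colProj X₁₁.D * X₁₁.M * A₁₂)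
        + (αl * α)⁻¹ • (colProj X₂₁.D * X₂₁.M * A₂₂_1)
      let L₃ := αk⁻¹ • (A₂₁ * X₁₁.W * rowProj X₁₁.D)
        + (αm * αk * α)⁻¹ • (compl X₂₁.D * X₂₁.M * A₂₂_1 * X₁₂.W * rowProj X₁₂.D)
      let L := joinBlocks (X₁₁.L * L₁₂) 0 L₃ (X₂₁.L * X₂₂.L)
      let D := joinBlocks X₁₁.D ((lam ^ 2)⁻¹ • X₁₂.D) X₂₁.D X₂₂.D
      let U := joinBlocks (X₂₁.U * X₁₁.U) U₂ 0 (X₂₂.U * U₁₂)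
      let Dhat := (α * αr⁻¹) • D + αr⁻¹ • compl D
      let P₁ := weight lam⁻¹ (rowProj X₁₂.D) * X₁₂.Dhat * X₁₂.M * X₁₁.Dhat * X₁₁.M
      let P₄ := X₂₂.Dhat * X₂₂.M * X₂₁.Dhat * X₂₁.M
      let Q₁ := X₁₁.W * X₁₁.Dhat * X₂₁.W * X₂₁.Dhat
      let Q₄ := X₁₂.W * X₁₂.Dhat * weight lam⁻¹ (colProj X₁₂.D) * X₂₂.W * X₂₂.Dhat
      { L := L
        D := D
        U := U
        M := Dhat⁻¹ * joinBlocks P₁ 0 (-(P₄ * L₃ * P₁)) P₄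
        Dhat := Dhat
        W := joinBlocks Q₁ (-(Q₁ * U₂ * Q₄)) 0 Q₄ * Dhat⁻¹
        αr := αr }

end Algorithm

/-! ### Minors containing the corner block -/

section Minors

variable {R : Type*} [CommRing R] {N k : ℕ}

/-- The determinant of the `k × k` submatrix in the upper left corner of `𝓜`
(equal to `1` for `k = 0`). -/
def cornerMinor (𝓜 : Matrix (Fin N) (Fin N) R) (hk : k ≤ N) : R :=
  (𝓜.submatrix (Fin.castLE hk) (Fin.castLE hk)).det

/-- The determinant of the submatrix of `𝓜` formed by the first `k` rows followed by the rows
`s 0, s 1, …`, and by the first `k` columns followed by the columns `t 0, t 1, …`. -/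
def borderedMinor (𝓜 : Matrix (Fin N) (Fin N) R) (hk : k ≤ N) {m : ℕ} (s t : Fin m → Fin N) : R :=
  (𝓜.submatrix (Sum.elim (Fin.castLE hk) s) (Sum.elim (Fin.castLE hk) t)).det

/-- `A` is a matrix of surrounding minors relative to the `k × k` corner block of `𝓜`: row `i` of
`A` belongs to the row `ρ i` of `𝓜`, column `j` to the column `γ j`, and `A i j` is the determinant
of the corner block bordered by this row and this column. -/
def IsSurroundingMinors (𝓜 : Matrix (Fin N) (Fin N) R) (hk : k ≤ N) {n : ℕ}
    (ρ γ : Fin n → Fin N) (A : Matrix (Fin n) (Fin n) R) : Prop :=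
  ∀ i j, A i j = borderedMinor 𝓜 hk ![ρ i] ![γ j]

/-- The `i`-th minor in the nested sequence given by the rows `s` and the columns `t`: the corner
block is bordered by the first `i` of these rows and columns. -/
def nestedMinor (𝓜 : Matrix (Fin N) (Fin N) R) (hk : k ≤ N) {r : ℕ} (s t : Fin r → Fin N)
    (i : Fin (r + 1)) : R :=
  borderedMinor 𝓜 hk (m := (i : ℕ))
    (fun j => s (Fin.castLE (Nat.lt_succ_iff.mp i.isLt) j))
    (fun j => t (Fin.castLE (Nat.lt_succ_iff.mp i.isLt) j))

end Minors

/-- A matrix over `F` all of whose entries lie in (the image of) `R`. -/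
def IsOver (R : Type*) {F : Type*} [CommRing R] [Field F] [Algebra R F] {n : ℕ}
    (X : Matrix (Fin n) (Fin n) F) : Prop :=
  ∃ X₀ : Matrix (Fin n) (Fin n) R, X = X₀.map (algebraMap R F)

end LDU

/-!
Let `G = α⁻¹ A` over the fraction field. By Sylvester's identity (the determinant of a Schur
complement) a minor of `𝓜` bordering the corner block by rows `ρ s` and columns `γ t` equals
`α det G[s, t]` (`IsSurroundingMinors.map_borderedMinor_comp`), so the hypothesis on `A` only
enters through the fact that all `α det G[s, t]` lie in `R`. The proof separates the behaviour of
the recursion over the field from the integrality of its output.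

Over the field, the recursion is block Gaussian elimination with the pivots taken in the order
`11, 21, 12, 22` of the blocks. `Output.Correct` lists what one call guarantees: besides the three
factorizations, the triangular shape and the normalization of `L` and `U`, a list of pivot
positions in the order of which the pivot parts of `L` and `U` are triangular, with a chain
(`PivotChain`) `δ₀ = α, δ₁, δ₂, …` of diagonal entries such that `D` has the entries
`(δ_{q-1} δ_q)⁻¹`. The induction step `combine_correct` rests on one observation: where a row of
the input vanishes, `L` is trivial and `D` has no pivot
(`Output.Correct.diagonal_mul_of_mul_eq_zero`). As the factors `D̄` kill the pivot rows and columns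
of the earlier calls, this makes the blocks of `D`, `L` and `U` disjoint in the sense of
`RowsDisjoint` and `ColsDisjoint`; the block identities are then algebra in a noncommutative ring.
The chain of the call for the upper right block starts from `α_k` instead of `α_l`, and the factors
`λ` repair this.

The invariant says that `G` is a sum of pivot columns of `L` times pivot rows of `U`
(`IsElimination`), from which everything else follows by determinants: `δ_q` is the `q`-th nested
minor, and an entry of `L` in a pivot column is a bordered minor (`IsElimination.det_bordered`).
Since `D̂ M = L⁻¹`, the entries of `M` are those of `L⁻¹` scaled by entries of `D̂⁻¹`, and Cramer's
rule expresses these through minors (`IsElimination.inv_apply_of_mem`,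
`IsElimination.inv_apply_of_notMem`). The statements for `U` and `W` follow by transposition.
-/

namespace LDU

/-! ### Truncated weighted permutation matrices -/

section PermutationMatrices

variable {F : Type*} [Field F] {n : ℕ} {D : Matrix (Fin n) (Fin n) F}

theorem IsTruncWeightedPerm.transpose (h : IsTruncWeightedPerm D) :
    IsTruncWeightedPerm D.transpose := by
  obtain ⟨σ, hσ⟩ := h
  exact ⟨σ.symm, fun i j hij => by rw [← hσ j i hij, Equiv.symm_apply_apply]⟩

theorem IsTruncWeightedPerm.row_unique (h : IsTruncWeightedPerm D) {i j k : Fin n}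
    (hj : D i j ≠ 0) (hk : D i k ≠ 0) : j = k := by
  obtain ⟨σ, hσ⟩ := h
  rw [← hσ i j hj, ← hσ i k hk]

theorem IsTruncWeightedPerm.col_unique (h : IsTruncWeightedPerm D) {i j k : Fin n}
    (hi : D i k ≠ 0) (hj : D j k ≠ 0) : i = j :=
  h.transpose.row_unique hi hj

/-- A matrix whose nonzero entries form a partial bijection is a truncated weighted permutation
matrix: a partial bijection of a finite set extends to a permutation. -/
theorem isTruncWeightedPerm_of_injective {r : ℕ} {s t : Fin r → Fin n}
    (hs : Function.Injective s) (ht : Function.Injective t)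
    (h : ∀ i j, D i j ≠ 0 → ∃ q, s q = i ∧ t q = j) : IsTruncWeightedPerm D := by
  classical
  let e : {x // x ∈ Set.range s} ≃ {x // x ∈ Set.range t} :=
    (Equiv.ofInjective s hs).symm.trans (Equiv.ofInjective t ht)
  refine ⟨e.extendSubtype, fun i j hij => ?_⟩
  obtain ⟨q, rfl, rfl⟩ := h i j hij
  rw [Equiv.extendSubtype_apply_of_mem e (s q) ⟨q, rfl⟩]
  change ((Equiv.ofInjective t ht ((Equiv.ofInjective s hs).symm (Equiv.ofInjective s hs q)) :
    Set.range t) : Fin n) = t q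
  rw [Equiv.symm_apply_apply, Equiv.ofInjective_apply]

theorem pinv_transpose : pinv D.transpose = (pinv D).transpose := rfl

variable [DecidableEq F]

theorem rowProj_transpose : rowProj D.transpose = colProj D := rfl

theorem transpose_rowProj : (rowProj D).transpose = rowProj D := by
  rw [rowProj, Matrix.transpose_mul, Matrix.transpose_transpose]

theorem transpose_colProj : (colProj D).transpose = colProj D := by
  rw [colProj, Matrix.transpose_mul, Matrix.transpose_transpose]

theorem compl_transpose : compl D.transpose = (compl D).transpose := by
  ext i j
  simp only [compl, Matrix.of_apply, Matrix.transpose_apply]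
  refine if_congr ?_ rfl rfl
  change i ∈ zeroCols D ∧ j ∈ zeroRows D ∧ _ = _ ↔ j ∈ zeroRows D ∧ i ∈ zeroCols D ∧ _ = _
  constructor
  · rintro ⟨h1, h2, h3⟩
    exact ⟨h2, h1, h3.symm⟩
  · rintro ⟨h1, h2, h3⟩
    exact ⟨h2, h1, h3.symm⟩

theorem mem_zeroRows {i : Fin n} : i ∈ zeroRows D ↔ ∀ j, D i j = 0 := by
  simp [zeroRows, funext_iff]

theorem mem_zeroCols {j : Fin n} : j ∈ zeroCols D ↔ ∀ i, D i j = 0 := by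
  simp [zeroCols, funext_iff]

theorem IsTruncWeightedPerm.rowProj_eq (h : IsTruncWeightedPerm D) :
    rowProj D = Matrix.diagonal fun i => if i ∈ zeroRows D then 0 else 1 := by
  ext i j
  rw [rowProj, Matrix.mul_apply, Matrix.diagonal_apply]
  simp only [unitMap, Matrix.of_apply, Matrix.transpose_apply]
  by_cases hi : i ∈ zeroRows D
  · simp [hi, mem_zeroRows.mp hi]
  obtain ⟨k, hk⟩ : ∃ k, D i k ≠ 0 := by simpa [mem_zeroRows] using hi
  rw [Finset.sum_eq_single k, if_neg hk, one_mul]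
  · by_cases hij : i = j
    · subst hij; simp [hk, hi]
    · have : D j k = 0 := by
        by_contra hj
        exact hij (h.col_unique hk hj)
      simp [this, hij]
  · intro b _ hb
    have : D i b = 0 := by
      by_contra hb'
      exact hb (h.row_unique hb' hk)
    simp [this]
  · simp

theorem IsTruncWeightedPerm.one_sub_rowProj (h : IsTruncWeightedPerm D) :
    1 - rowProj D = Matrix.diagonal fun i => if i ∈ zeroRows D then 1 else 0 := by
  rw [h.rowProj_eq, ← Matrix.diagonal_one, Matrix.diagonal_sub]
  congr 1
  ext i
  split_ifs <;> simp

theorem IsTruncWeightedPerm.rowProj_mul_apply (h : IsTruncWeightedPerm D)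
    (Y : Matrix (Fin n) (Fin n) F) (i j : Fin n) :
    (rowProj D * Y) i j = if i ∈ zeroRows D then 0 else Y i j := by
  rw [h.rowProj_eq, Matrix.diagonal_mul]
  split_ifs <;> simp

theorem IsTruncWeightedPerm.mul_rowProj_apply (h : IsTruncWeightedPerm D)
    (Y : Matrix (Fin n) (Fin n) F) (i j : Fin n) :
    (Y * rowProj D) i j = if j ∈ zeroRows D then 0 else Y i j := by
  rw [h.rowProj_eq, Matrix.mul_diagonal]
  split_ifs <;> simp

theorem IsTruncWeightedPerm.colProj_eq (h : IsTruncWeightedPerm D) :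
    colProj D = Matrix.diagonal fun j => if j ∈ zeroCols D then 0 else 1 :=
  h.transpose.rowProj_eq

theorem IsTruncWeightedPerm.one_sub_colProj (h : IsTruncWeightedPerm D) :
    1 - colProj D = Matrix.diagonal fun j => if j ∈ zeroCols D then 1 else 0 :=
  h.transpose.one_sub_rowProj

theorem IsTruncWeightedPerm.colProj_mul_apply (h : IsTruncWeightedPerm D)
    (Y : Matrix (Fin n) (Fin n) F) (i j : Fin n) :
    (colProj D * Y) i j = if i ∈ zeroCols D then 0 else Y i j :=
  h.transpose.rowProj_mul_apply Y i j

theorem IsTruncWeightedPerm.mul_colProj_apply (h : IsTruncWeightedPerm D)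
    (Y : Matrix (Fin n) (Fin n) F) (i j : Fin n) :
    (Y * colProj D) i j = if j ∈ zeroCols D then 0 else Y i j :=
  h.transpose.mul_rowProj_apply Y i j

theorem IsTruncWeightedPerm.rowProj_mul_rowProj (h : IsTruncWeightedPerm D) :
    rowProj D * rowProj D = rowProj D := by
  ext i j
  rw [h.rowProj_mul_apply, h.rowProj_eq, Matrix.diagonal_apply]
  split_ifs <;> simp_all

theorem IsTruncWeightedPerm.colProj_mul_colProj (h : IsTruncWeightedPerm D) :
    colProj D * colProj D = colProj D :=
  h.transpose.rowProj_mul_rowProj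

theorem IsTruncWeightedPerm.rowProj_mul (h : IsTruncWeightedPerm D) : rowProj D * D = D := by
  ext i j
  rw [h.rowProj_mul_apply]
  split_ifs with hi
  · exact (mem_zeroRows.mp hi j).symm
  · rfl

theorem IsTruncWeightedPerm.mul_colProj (h : IsTruncWeightedPerm D) : D * colProj D = D := by
  have := congrArg Matrix.transpose h.transpose.rowProj_mul
  rwa [Matrix.transpose_mul, Matrix.transpose_transpose, rowProj_transpose,
    transpose_colProj] at this

theorem IsTruncWeightedPerm.mul_pinv (h : IsTruncWeightedPerm D) : D * pinv D = rowProj D := by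
  ext i j
  rw [h.rowProj_eq, Matrix.mul_apply, Matrix.diagonal_apply]
  simp only [pinv, Matrix.of_apply]
  by_cases hi : i ∈ zeroRows D
  · simp [hi, mem_zeroRows.mp hi]
  obtain ⟨k, hk⟩ : ∃ k, D i k ≠ 0 := by simpa [mem_zeroRows] using hi
  rw [Finset.sum_eq_single k]
  · by_cases hij : i = j
    · subst hij; simp [hk, hi]
    · have : D j k = 0 := by
        by_contra hj
        exact hij (h.col_unique hk hj)
      simp [this, hij]
  · intro b _ hb
    have : D i b = 0 := by
      by_contra hb'
      exact hb (h.row_unique hb' hk)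
    simp [this]
  · simp

theorem card_filter_lt_lt {S : Finset (Fin n)} {i : Fin n} (hi : i ∈ S) {j : Fin n} (hij : i < j) :
    (S.filter (· < i)).card < (S.filter (· < j)).card := by
  refine Finset.card_lt_card ⟨fun x hx => ?_, fun hsub => ?_⟩
  · rw [Finset.mem_filter] at hx ⊢
    exact ⟨hx.1, hx.2.trans hij⟩
  · exact lt_irrefl i (Finset.mem_filter.mp (hsub (Finset.mem_filter.mpr ⟨hi, hij⟩))).2

theorem card_filter_lt_lt_card {S : Finset (Fin n)} {i : Fin n} (hi : i ∈ S) :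
    (S.filter (· < i)).card < S.card := by
  refine Finset.card_lt_card ⟨Finset.filter_subset _ _, fun hsub => ?_⟩
  exact lt_irrefl i (Finset.mem_filter.mp (hsub hi)).2

theorem card_filter_lt_injOn (S : Finset (Fin n)) :
    Set.InjOn (fun j => (S.filter (· < j)).card) (S : Set (Fin n)) := by
  intro i hi j hj h
  rcases lt_trichotomy i j with hlt | heq | hlt
  · exact absurd h (card_filter_lt_lt hi hlt).ne
  · exact heq
  · exact absurd h (card_filter_lt_lt hj hlt).ne'

/-- Counting the smaller elements numbers the elements of a finite set by an initial segment. -/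
theorem exists_mem_card_filter_lt_eq (S : Finset (Fin n)) {c : ℕ} (hc : c < S.card) :
    ∃ j ∈ S, (S.filter (· < j)).card = c := by
  have himg : S.image (fun j => (S.filter (· < j)).card) = Finset.range S.card := by
    apply Finset.eq_of_subset_of_card_le
    · intro x hx
      obtain ⟨j, hj, rfl⟩ := Finset.mem_image.mp hx
      exact Finset.mem_range.mpr (card_filter_lt_lt_card hj)
    · rw [Finset.card_range, Finset.card_image_of_injOn (card_filter_lt_injOn S)]
  have := Finset.mem_range.mpr hc
  rw [← himg] at this
  simpa using this

theorem IsTruncWeightedPerm.card_zeroRows (h : IsTruncWeightedPerm D) :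
    (zeroRows D).card = (zeroCols D).card := by
  obtain ⟨σ, hσ⟩ := h
  have : zeroCols D = (zeroRows D).map σ.toEmbedding := by
    ext j
    rw [Finset.mem_map_equiv, mem_zeroRows, mem_zeroCols]
    constructor
    · intro hj k
      by_contra hk
      have := hσ _ _ hk
      rw [Equiv.apply_symm_apply] at this
      exact hk (this ▸ hj _)
    · intro hj i
      by_contra hi
      have := hσ _ _ hi
      rw [← this, Equiv.symm_apply_apply] at hj
      rw [← this] at hi
      exact hi (hj _)
  rw [this, Finset.card_map]

/-- A zero row of `D` meets a single zero column in a nonzero entry of `D̄`. -/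
theorem IsTruncWeightedPerm.exists_compl_row (h : IsTruncWeightedPerm D) {i : Fin n}
    (hi : i ∈ zeroRows D) : ∃ j ∈ zeroCols D, ∀ k, compl D i k = if k = j then 1 else 0 := by
  have hlt : ((zeroRows D).filter (· < i)).card < (zeroCols D).card := by
    rw [← h.card_zeroRows]
    exact card_filter_lt_lt_card hi
  obtain ⟨j, hj, hjc⟩ := exists_mem_card_filter_lt_eq _ hlt
  refine ⟨j, hj, fun k => ?_⟩
  simp only [compl, Matrix.of_apply]
  refine if_congr ⟨?_, ?_⟩ rfl rfl
  · rintro ⟨_, hk, hc⟩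
    exact card_filter_lt_injOn _ hk hj (hc.symm.trans hjc.symm)
  · rintro rfl
    exact ⟨hi, hj, hjc.symm⟩

/-- Every zero column of `D` carries a nonzero entry of `D̄`, alone in its row. -/
theorem IsTruncWeightedPerm.exists_compl_row_of_col (h : IsTruncWeightedPerm D) {j : Fin n}
    (hj : j ∈ zeroCols D) : ∃ i ∈ zeroRows D, ∀ k, compl D i k = if k = j then 1 else 0 := by
  obtain ⟨i, hi, hij⟩ := h.transpose.exists_compl_row (i := j) hj
  refine ⟨i, hi, fun k => ?_⟩
  obtain ⟨j', _, hj'⟩ := h.exists_compl_row (i := i) hi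
  have h1 : compl D i j = 1 := by
    have := hij i
    rwa [compl_transpose, Matrix.transpose_apply, if_pos rfl] at this
  have : j = j' := by
    by_contra hne
    rw [hj', if_neg hne] at h1
    exact zero_ne_one h1
  rw [hj', this]

theorem compl_eq_zero_of_row {i : Fin n} (hi : i ∉ zeroRows D) (j : Fin n) : compl D i j = 0 := by
  simp [compl, hi]

theorem compl_eq_zero_of_col {j : Fin n} (hj : j ∉ zeroCols D) (i : Fin n) : compl D i j = 0 := by
  simp [compl, hj]

theorem IsTruncWeightedPerm.rowProj_mul_compl (h : IsTruncWeightedPerm D) :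
    rowProj D * compl D = 0 := by
  ext i j
  rw [h.rowProj_mul_apply]
  split_ifs with hi
  · rfl
  · exact compl_eq_zero_of_row hi j

theorem IsTruncWeightedPerm.compl_mul_colProj (h : IsTruncWeightedPerm D) :
    compl D * colProj D = 0 := by
  have := congrArg Matrix.transpose h.transpose.rowProj_mul_compl
  rwa [compl_transpose, Matrix.transpose_mul, Matrix.transpose_transpose, rowProj_transpose,
    transpose_colProj, Matrix.transpose_zero] at this

theorem compl_mul_pinv : compl D * pinv D = 0 := by
  ext i j
  rw [Matrix.mul_apply, Matrix.zero_apply]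
  refine Finset.sum_eq_zero fun k _ => ?_
  by_cases hk : k ∈ zeroCols D
  · simp [pinv, mem_zeroCols.mp hk]
  · rw [compl_eq_zero_of_col hk, zero_mul]

theorem mul_compl_transpose : D * (compl D).transpose = 0 := by
  ext i j
  rw [Matrix.mul_apply, Matrix.zero_apply]
  refine Finset.sum_eq_zero fun k _ => ?_
  by_cases hk : k ∈ zeroCols D
  · simp [mem_zeroCols.mp hk]
  · rw [Matrix.transpose_apply, compl_eq_zero_of_col hk, mul_zero]

theorem IsTruncWeightedPerm.compl_mul_compl_transpose (h : IsTruncWeightedPerm D) :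
    compl D * (compl D).transpose = 1 - rowProj D := by
  ext i j
  rw [h.one_sub_rowProj, Matrix.mul_apply, Matrix.diagonal_apply]
  simp only [Matrix.transpose_apply]
  by_cases hi : i ∈ zeroRows D
  · obtain ⟨k, hk, hik⟩ := h.exists_compl_row hi
    simp only [hik, ite_mul, one_mul, zero_mul, Finset.sum_ite_eq', Finset.mem_univ, if_true, hi]
    obtain ⟨i', hi', hik'⟩ := h.transpose.exists_compl_row (i := k) hk
    have hcol : ∀ l, compl D l k = if l = i' then 1 else 0 := fun l => by
      rw [← hik' l, compl_transpose, Matrix.transpose_apply]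
    have : i = i' := by
      by_contra hne
      have := hcol i
      rw [hik, if_pos rfl, if_neg hne] at this
      exact one_ne_zero this
    rw [hcol, ← this]
    simp only [eq_comm]
  · rw [Finset.sum_eq_zero]
    · simp [hi]
    · intro k _
      rw [compl_eq_zero_of_row hi, zero_mul]

theorem IsTruncWeightedPerm.isUnit_smul_add_smul_compl (h : IsTruncWeightedPerm D) {c d : F}
    (hc : c ≠ 0) (hd : d ≠ 0) : IsUnit (c • D + d • compl D) := by
  refine IsUnit.of_mul_eq_one (c⁻¹ • pinv D + d⁻¹ • (compl D).transpose) ?_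
  simp only [add_mul, mul_add, smul_mul_assoc, mul_smul_comm, compl_mul_pinv, mul_compl_transpose,
    h.mul_pinv, h.compl_mul_compl_transpose, smul_zero, add_zero, zero_add, smul_smul,
    inv_mul_cancel₀ hc, inv_mul_cancel₀ hd, one_smul, add_sub_cancel]

/-- For a combination `D̂` of `D` and `D̄`, only the part along `D` survives in `D̂ D⁺ D̂`. -/
theorem IsTruncWeightedPerm.smul_add_smul_compl_mul_pinv_mul (h : IsTruncWeightedPerm D)
    (c d : F) : (c • D + d • compl D) * pinv D * (c • D + d • compl D) = c ^ 2 • D := by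
  simp only [add_mul, mul_add, smul_mul_assoc, mul_smul_comm, compl_mul_pinv,
    h.mul_pinv, h.rowProj_mul, h.rowProj_mul_compl, smul_zero, add_zero, smul_smul, sq]

/-- A diagonal matrix `P` that annihilates a product `L D U` from the left, with `U` invertible
and `L` trivial on the zero rows of `D`, does not see the pivot rows of `D`. -/
theorem IsTruncWeightedPerm.diagonal_mul_of_mul_eq_zero (h : IsTruncWeightedPerm D)
    {L U : Matrix (Fin n) (Fin n) F} {d : Fin n → F} (hL : ∀ i, L i i ≠ 0)
    (hnorm : L * (1 - rowProj D) = 1 - rowProj D) (hU : IsUnit U)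
    (hd : Matrix.diagonal d * (L * D * U) = 0) :
    Matrix.diagonal d * L = Matrix.diagonal d ∧ Matrix.diagonal d * rowProj D = 0 := by
  have h0 : Matrix.diagonal d * L * D = 0 := by
    rw [← mul_assoc, ← mul_assoc] at hd
    exact (IsUnit.mul_left_eq_zero hU).mp hd
  have h1 : Matrix.diagonal d * L * rowProj D = 0 := by
    rw [← h.mul_pinv, ← mul_assoc, h0, zero_mul]
  have h2 : Matrix.diagonal d * rowProj D = 0 := by
    ext i j
    have := congrFun (congrFun h1 i) i
    rw [h.mul_rowProj_apply, Matrix.diagonal_mul, Matrix.zero_apply] at this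
    rw [h.mul_rowProj_apply, Matrix.diagonal_apply, Matrix.zero_apply]
    split_ifs with hj hij
    · rfl
    · rw [← hij] at hj
      rw [if_neg hj] at this
      exact (mul_eq_zero.mp this).resolve_right (hL i)
    · rfl
  refine ⟨?_, h2⟩
  calc Matrix.diagonal d * L
      = Matrix.diagonal d * L * rowProj D + Matrix.diagonal d * (L * (1 - rowProj D)) := by
        noncomm_ring
    _ = Matrix.diagonal d := by rw [h1, hnorm, mul_sub, h2, mul_one, sub_zero, zero_add]

end PermutationMatrices

/-! ### Elimination along a sequence of pivots -/

section Elimination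

variable {F : Type*} [Field F] {n r : ℕ}

/-- A factorization of `G` by elimination with the pivot positions `(s 0, t 0), (s 1, t 1), …`:
`G` is the sum of the products of the pivot columns of `L` with the pivot rows of `U`, weighted
by `(δ q * δ (q + 1))⁻¹`. The pivot part of `L` is lower triangular and that of `U` upper
triangular in the order of the pivots, both with the diagonal entries `δ 1, δ 2, …`. -/
structure IsElimination (G : Matrix (Fin n) (Fin n) F) (s t : Fin r → Fin n) (δ : ℕ → F)
    (L U : Matrix (Fin n) (Fin n) F) : Prop where
  ne_zero : ∀ q ≤ r, δ q ≠ 0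
  apply_eq : ∀ i j, G i j = ∑ q : Fin r, L i (s q) * (δ q * δ (q + 1))⁻¹ * U (t q) j
  left_zero : ∀ q q', q < q' → L (s q) (s q') = 0
  right_zero : ∀ q q', q < q' → U (t q') (t q) = 0
  left_diag : ∀ q : Fin r, L (s q) (s q) = δ (q + 1)
  right_diag : ∀ q : Fin r, U (t q) (t q) = δ (q + 1)

variable {G L U : Matrix (Fin n) (Fin n) F} {s t : Fin r → Fin n} {δ : ℕ → F}

theorem IsElimination.transpose (h : IsElimination G s t δ L U) :
    IsElimination G.transpose t s δ U.transpose L.transpose where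
  ne_zero := h.ne_zero
  apply_eq i j := by
    rw [Matrix.transpose_apply, h.apply_eq]
    refine Finset.sum_congr rfl fun q _ => ?_
    simp only [Matrix.transpose_apply]
    ring
  left_zero := h.right_zero
  right_zero := h.left_zero
  left_diag := h.right_diag
  right_diag := h.left_diag

theorem IsElimination.left_injective (h : IsElimination G s t δ L U) : Function.Injective s := by
  intro q q' hq
  by_contra hne
  rcases lt_or_gt_of_ne hne with hlt | hlt
  · have := h.left_zero q q' hlt
    rw [← hq, h.left_diag] at this
    exact h.ne_zero _ q.isLt this
  · have := h.left_zero q' q hlt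
    rw [← hq, h.left_diag] at this
    exact h.ne_zero _ q.isLt this

/-- Restricted to the first `m` pivot columns, and to rows the first `m - 1` of which are pivot
rows, an elimination is a product of a lower triangular, a diagonal and an upper triangular
matrix. -/
theorem IsElimination.det_submatrix (h : IsElimination G s t δ L U) {m : ℕ} (hm : m ≤ r)
    (u : Fin m → Fin n) (hu : ∀ c : Fin m, (c : ℕ) + 1 < m → u c = s (Fin.castLE hm c)) :
    (G.submatrix u fun c => t (Fin.castLE hm c)).det =
      (∏ c : Fin m, L (u c) (s (Fin.castLE hm c))) * ∏ c : Fin m, (δ c)⁻¹ := by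
  have hfac : (G.submatrix u fun c => t (Fin.castLE hm c)) =
      (L.submatrix u fun c => s (Fin.castLE hm c)) *
        Matrix.diagonal (fun c : Fin m => (δ c * δ (c + 1))⁻¹) *
        (U.submatrix (fun c => t (Fin.castLE hm c)) fun c => t (Fin.castLE hm c)) := by
    ext i j
    rw [Matrix.mul_apply, Matrix.submatrix_apply, h.apply_eq]
    simp only [Matrix.submatrix_apply, Matrix.mul_diagonal]
    -- the pivots beyond the `m`-th contribute nothing in the first `m` pivot columns
    refine (Finset.sum_of_injOn (Fin.castLE hm) (Fin.castLE_injective hm).injOn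
      (fun _ _ => by simp) ?_ fun c _ => by simp).symm
    intro q _ hq
    rw [h.right_zero _ q, mul_zero]
    rw [Fin.lt_def]
    by_contra hlt
    rw [Fin.val_castLE, not_lt] at hlt
    exact hq ⟨⟨q, hlt.trans_lt j.isLt⟩, by simp, by ext; simp⟩
  rw [hfac, Matrix.det_mul, Matrix.det_mul, Matrix.det_diagonal,
    Matrix.det_of_isLowerTriangular, Matrix.det_of_isUpperTriangular]
  · simp only [Matrix.submatrix_apply, h.right_diag, mul_inv, Finset.prod_mul_distrib,
      Fin.val_castLE]
    rw [mul_assoc, mul_assoc, ← Finset.prod_mul_distrib (f := fun c : Fin m => (δ (c + 1))⁻¹),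
      Finset.prod_eq_one (f := fun c : Fin m => (δ (c + 1))⁻¹ * δ (c + 1)), mul_one]
    intro c _
    exact inv_mul_cancel₀ (h.ne_zero _ (by omega))
  · intro i j hij
    exact h.right_zero _ _ hij
  · intro i j hij
    have hij' : i < j := hij
    rw [Matrix.submatrix_apply, hu i (by omega)]
    exact h.left_zero _ _ hij'

/-- An entry of `L` in a pivot column is a minor of `G` up to the factor `δ 0`. -/
theorem IsElimination.det_bordered (h : IsElimination G s t δ L U) {m : ℕ} (hm : m + 1 ≤ r)
    (u : Fin (m + 1) → Fin n)
    (hu : ∀ c : Fin (m + 1), (c : ℕ) + 1 < m + 1 → u c = s (Fin.castLE hm c)) :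
    δ 0 * (G.submatrix u fun c => t (Fin.castLE hm c)).det =
      L (u (Fin.last m)) (s (Fin.castLE hm (Fin.last m))) := by
  have h0 : δ 0 ≠ 0 := h.ne_zero 0 (Nat.zero_le _)
  have hL : ∀ c : Fin m, L (u c.castSucc) (s (Fin.castLE hm c.castSucc)) = δ (c + 1) := by
    intro c
    rw [hu _ (by simp), h.left_diag]
    simp
  rw [h.det_submatrix hm u hu, Fin.prod_univ_castSucc, Fin.prod_univ_succ (fun c => (δ _)⁻¹)]
  simp only [hL, Fin.val_zero, Fin.val_succ]
  have hP : (∏ c : Fin m, δ (c + 1)) * ∏ c : Fin m, (δ (c + 1))⁻¹ = 1 := by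
    rw [← Finset.prod_mul_distrib]
    exact Finset.prod_eq_one fun c _ => mul_inv_cancel₀ (h.ne_zero _ (by omega))
  calc _ = (δ 0 * (δ 0)⁻¹) * ((∏ c : Fin m, δ (c + 1)) * ∏ c : Fin m, (δ (c + 1))⁻¹) *
        L (u (Fin.last m)) (s (Fin.castLE hm (Fin.last m))) := by ring
    _ = _ := by rw [mul_inv_cancel₀ h0, hP, one_mul, one_mul]

theorem IsElimination.det_pivots (h : IsElimination G s t δ L U) {m : ℕ} (hm : m ≤ r) :
    δ 0 * (G.submatrix (fun c => s (Fin.castLE hm c)) fun c => t (Fin.castLE hm c)).det = δ m := by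
  cases m with
  | zero => simp
  | succ m =>
    rw [h.det_bordered hm _ fun _ _ => rfl, h.left_diag]
    simp

/-- The nonpivot rows of `L⁻¹`, by Cramer's rule: multiplied with the last of the `δ`, their
entries are minors of `G` in the pivot columns, up to sign and the factor `δ 0`. -/
theorem IsElimination.inv_apply_of_notMem (h : IsElimination G s t δ L U)
    (hL : ∀ j, j ∉ Set.range s → ∀ i, L i j = (1 : Matrix (Fin n) (Fin n) F) i j)
    {Y : Matrix (Fin n) (Fin n) F} (hY : Y * L = 1) {i : Fin n} (hi : i ∉ Set.range s)
    (c : Fin r) :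
    δ r * Y i (s c) = -(δ 0 * (G.submatrix (Function.update s c i) t).det) := by
  have hs := h.left_injective
  have hnon : ∀ j, j ∉ Set.range s → Y i j = (1 : Matrix (Fin n) (Fin n) F) i j := by
    intro j hj
    rw [← hY, Matrix.mul_apply]
    simp [hL j hj, Matrix.one_apply]
  -- the row of `Y` annihilates the pivot columns of `L`, hence all columns of `G`
  have hYG : ∀ j, ∑ k, Y i k * G k j = 0 := by
    intro j
    have : ∀ q : Fin r, ∑ k, Y i k * L k (s q) = 0 := fun q => by
      rw [← Matrix.mul_apply, hY, Matrix.one_apply_ne]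
      rintro rfl
      exact hi ⟨q, rfl⟩
    simp only [h.apply_eq, Finset.mul_sum]
    rw [Finset.sum_comm]
    refine Finset.sum_eq_zero fun q _ => ?_
    simp only [← mul_assoc, ← Finset.sum_mul, this, zero_mul]
  -- on the pivot columns this is a linear system for the pivot entries of the row
  have hz : Matrix.vecMul (fun c => Y i (s c)) (G.submatrix s t) = -fun c => G i (t c) := by
    funext c
    have := hYG (t c)
    rw [← Finset.sum_subset (Finset.subset_univ (insert i (Finset.univ.image s))),
      Finset.sum_insert, Finset.sum_image hs.injOn, hnon i hi, Matrix.one_apply_eq, one_mul,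
      add_comm] at this
    · exact eq_neg_of_add_eq_zero_left this
    · simpa using hi
    · intro k _ hk
      simp only [Finset.mem_insert, Finset.mem_image, Finset.mem_univ, true_and, not_or] at hk
      rw [hnon k (by simpa using hk.2), Matrix.one_apply_ne (Ne.symm hk.1), zero_mul]
  have hdet : δ 0 * (G.submatrix s t).det = δ r := h.det_pivots le_rfl
  have key := congrArg (fun v => Matrix.vecMul v (G.submatrix s t).adjugate c) hz
  simp only [Matrix.vecMul_vecMul, Matrix.mul_adjugate, Matrix.neg_vecMul, Pi.neg_apply,
    Matrix.vecMul_smul, Matrix.vecMul_one, Pi.smul_apply, smul_eq_mul] at key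
  have hcr : Matrix.vecMul (fun c => G i (t c)) (G.submatrix s t).adjugate c =
      (G.submatrix (Function.update s c i) t).det := by
    rw [← Matrix.mulVec_transpose, Matrix.adjugate_transpose, ← Matrix.cramer_eq_adjugate_mulVec,
      Matrix.cramer_transpose_apply]
    congr 1
    ext a b
    by_cases hac : a = c
    · subst hac; simp
    · simp [hac]
  rw [hcr] at key
  rw [← hdet, mul_assoc, key, mul_neg]

/-- The pivot rows of `L⁻¹`: scaled by two consecutive `δ`, their entries are cofactors of the
leading pivot minors. -/
theorem IsElimination.inv_apply_of_mem (h : IsElimination G s t δ L U)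
    (hL : ∀ j, j ∉ Set.range s → ∀ i, L i j = (1 : Matrix (Fin n) (Fin n) F) i j)
    {Y : Matrix (Fin n) (Fin n) F} (hY : Y * L = 1) (q : Fin r) (j : Fin n) :
    (∃ c : Fin (q + 1), δ q * δ (q + 1) * Y (s q) j =
      δ 0 * (G.submatrix (fun c => s (Fin.castLE q.isLt c))
        fun c => t (Fin.castLE q.isLt c)).adjugate (Fin.last q) c) ∨ Y (s q) j = 0 := by
  have hs := h.left_injective
  have hnon : ∀ j, j ∉ Set.range s → Y (s q) j = 0 := by
    intro j hj
    have : (1 : Matrix (Fin n) (Fin n) F) (s q) j = Y (s q) j := by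
      rw [← hY, Matrix.mul_apply]
      simp [hL j hj, Matrix.one_apply]
    rw [← this, Matrix.one_apply_ne]
    rintro rfl
    exact hj ⟨q, rfl⟩
  have hsupp : ∀ c : Fin r, q < c → Y (s q) (s c) = 0 := by
    intro c hc
    -- the pivot block of `Y` is the inverse of a lower triangular matrix
    have hinv : Y.submatrix s s * L.submatrix s s = 1 := by
      ext a b
      rw [Matrix.mul_apply, ← Matrix.submatrix_one s hs, ← hY, Matrix.submatrix_apply,
        Matrix.mul_apply, ← Finset.sum_subset (Finset.subset_univ (Finset.univ.image s)),
        Finset.sum_image hs.injOn]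
      · rfl
      · intro k _ hk
        have hk' : k ∉ Set.range s := by simpa using hk
        have : (1 : Matrix (Fin n) (Fin n) F) (s a) k = Y (s a) k := by
          rw [← hY, Matrix.mul_apply]
          simp [hL k hk', Matrix.one_apply]
        rw [← this, Matrix.one_apply_ne, zero_mul]
        rintro rfl
        exact hk' ⟨a, rfl⟩
    have htri : (L.submatrix s s).BlockTriangular OrderDual.toDual := fun a b hab =>
      h.left_zero _ _ hab
    let : Invertible (L.submatrix s s) := ⟨_, hinv, mul_eq_one_comm.mp hinv⟩
    have := Matrix.blockTriangular_inv_of_blockTriangular htri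
    rw [Matrix.inv_eq_left_inv hinv] at this
    exact this (i := q) (j := c) hc
  -- the row of `Y` picks a single term of the sum that represents `G`
  have hYG : ∀ j, ∑ k, Y (s q) k * G k j = (δ q * δ (q + 1))⁻¹ * U (t q) j := by
    intro j
    have : ∀ q' : Fin r, ∑ k, Y (s q) k * L k (s q') = if q' = q then 1 else 0 := fun q' => by
      rw [← Matrix.mul_apply, hY, Matrix.one_apply]
      simp only [hs.eq_iff, eq_comm]
    simp only [h.apply_eq, Finset.mul_sum]
    rw [Finset.sum_comm]
    simp only [← mul_assoc, ← Finset.sum_mul, this]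
    simp
  have hinj : Function.Injective fun c : Fin (q + 1) => s (Fin.castLE q.isLt c) :=
    hs.comp (Fin.castLE_injective _)
  by_cases hj : j ∈ Set.range s
  swap
  · exact Or.inr (hnon j hj)
  obtain ⟨c, rfl⟩ := hj
  by_cases hc : q < c
  · exact Or.inr (hsupp c hc)
  refine Or.inl ⟨⟨c, by omega⟩, ?_⟩
  set Gq := G.submatrix (fun c : Fin (q + 1) => s (Fin.castLE q.isLt c))
    fun c => t (Fin.castLE q.isLt c) with hGq
  -- in the first `q + 1` pivot columns only the last entry of the row `t q` of `U` is nonzero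
  have hz : Matrix.vecMul (fun c : Fin (q + 1) => Y (s q) (s (Fin.castLE q.isLt c))) Gq =
      (δ q)⁻¹ • Pi.single (Fin.last q) 1 := by
    funext b
    have hb := hYG (t (Fin.castLE q.isLt b))
    rw [← Finset.sum_subset (Finset.subset_univ (Finset.univ.image
      fun c : Fin (q + 1) => s (Fin.castLE q.isLt c))), Finset.sum_image
      hinj.injOn] at hb
    · refine Eq.trans hb ?_
      by_cases hbq : b = Fin.last q
      · subst hbq
        have : Fin.castLE q.isLt (Fin.last (q : ℕ)) = q := by ext; simp
        rw [this, h.right_diag, mul_inv, mul_assoc, inv_mul_cancel₀ (h.ne_zero _ q.isLt)]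
        simp
      · have : b < Fin.last q := Fin.lt_last_iff_ne_last.mpr hbq
        rw [h.right_zero _ _ (by simpa [Fin.lt_def] using this), mul_zero]
        simp [hbq]
    · intro k _ hk
      by_cases hk' : k ∈ Set.range s
      · obtain ⟨d, rfl⟩ := hk'
        rw [hsupp d, zero_mul]
        by_contra hd
        exact hk (Finset.mem_image.mpr ⟨⟨d, by omega⟩, by simp, by congr 1⟩)
      · rw [hnon k hk', zero_mul]
  have hdet : δ 0 * Gq.det = δ (q + 1) := h.det_pivots q.isLt
  have key := congrArg (fun v => Matrix.vecMul v Gq.adjugate ⟨c, by omega⟩) hz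
  simp only [Matrix.vecMul_vecMul, Matrix.mul_adjugate, Matrix.smul_vecMul,
    Matrix.vecMul_smul, Matrix.vecMul_one, Pi.smul_apply, smul_eq_mul,
    Matrix.single_one_vecMul, Matrix.row_apply] at key
  have hδ : δ q ≠ 0 := h.ne_zero _ q.isLt.le
  calc δ q * δ (q + 1) * Y (s q) (s c) = δ q * δ 0 * (Gq.det * Y (s q) (s c)) := by
        rw [← hdet]; ring
    _ = δ q * δ 0 * ((δ q)⁻¹ * Gq.adjugate (Fin.last q) ⟨c, by omega⟩) := by
        rw [← key]; rfl
    _ = (δ q * (δ q)⁻¹) * (δ 0 * Gq.adjugate (Fin.last q) ⟨c, by omega⟩) := by ring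
    _ = _ := by rw [mul_inv_cancel₀ hδ, one_mul]

end Elimination

/-! ### The pivot order -/

/-- The sequence `l` of positions carries the entries `(a₀ a₁)⁻¹, (a₁ a₂)⁻¹, …` of `D`, where
`a₀ = a`, the nonzero elements `a₁, a₂, …` are the corresponding diagonal entries of `L`, and
the last element of the sequence `a₀, a₁, …` is `b`. -/
inductive PivotChain {ι κ F : Type*} [Field F] (D : Matrix ι κ F) (L : Matrix ι ι F) :
    F → List (ι × κ) → F → Prop
  | nil (a : F) : PivotChain D L a [] a
  | cons {a b : F} {s : ι} {t : κ} {l : List (ι × κ)} (hD : D s t = (a * L s s)⁻¹)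
      (hL : L s s ≠ 0) (h : PivotChain D L (L s s) l b) : PivotChain D L a ((s, t) :: l) b

namespace PivotChain

variable {ι κ F : Type*} [Field F] {D : Matrix ι κ F} {L : Matrix ι ι F} {a b c : F}
  {l l' : List (ι × κ)}

theorem append (h : PivotChain D L a l b) (h' : PivotChain D L b l' c) :
    PivotChain D L a (l ++ l') c := by
  induction h with
  | nil => exact h'
  | cons hD hL _ ih => exact .cons hD hL (ih h')

/-- A chain may be transported to other matrices; the diagonal entries of `L` may be scaled by a
common factor. -/
theorem map {ι' κ' : Type*} {D' : Matrix ι' κ' F} {L' : Matrix ι' ι' F}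
    (h : PivotChain D L a l b) (f : ι → ι') (g : κ → κ') {c : F} (hc : c ≠ 0)
    (hD : ∀ x ∈ l, D' (f x.1) (g x.2) = (c ^ 2)⁻¹ * D x.1 x.2)
    (hL : ∀ x ∈ l, L' (f x.1) (f x.1) = c * L x.1 x.1) :
    PivotChain D' L' (c * a) (l.map (Prod.map f g)) (c * b) := by
  induction h with
  | nil => exact .nil _
  | cons hDs hLs _ ih =>
    have h1 := hL _ List.mem_cons_self
    have h2 := hD _ List.mem_cons_self
    refine .cons ?_ ?_ ?_
    · rw [h1, h2, hDs, ← mul_inv]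
      congr 1
      ring
    · rw [h1]
      exact mul_ne_zero hc hLs
    · rw [h1]
      exact ih (fun x hx => hD x (List.mem_cons_of_mem _ hx))
        fun x hx => hL x (List.mem_cons_of_mem _ hx)

theorem ne_zero (h : PivotChain D L a l b) (ha : a ≠ 0) : b ≠ 0 := by
  induction h with
  | nil => exact ha
  | cons _ hL _ ih => exact ih hL

theorem diag_ne_zero (h : PivotChain D L a l b) {x : ι × κ} (hx : x ∈ l) : L x.1 x.1 ≠ 0 := by
  induction h with
  | nil => simp at hx
  | cons _ hL _ ih =>
    rcases List.mem_cons.mp hx with rfl | hx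
    · exact hL
    · exact ih hx

/-- The chain as a sequence indexed by the natural numbers. -/
theorem exists_seq (h : PivotChain D L a l b) (ha : a ≠ 0) :
    ∃ δ : ℕ → F, δ 0 = a ∧ δ l.length = b ∧ (∀ q ≤ l.length, δ q ≠ 0) ∧
      ∀ q : Fin l.length, L (l.get q).1 (l.get q).1 = δ (q + 1) ∧
        D (l.get q).1 (l.get q).2 = (δ q * δ (q + 1))⁻¹ := by
  induction h with
  | nil a => exact ⟨fun _ => a, rfl, rfl, fun _ _ => ha, fun q => q.elim0⟩
  | @cons a b s t l hD hL _ ih =>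
    obtain ⟨δ, h0, hb, hne, hδ⟩ := ih hL
    refine ⟨fun q => q.casesOn a δ, rfl, hb, fun q hq => ?_, fun q => ?_⟩
    · cases q with
      | zero => exact ha
      | succ q => exact hne q (by simpa using hq)
    · refine Fin.cases ?_ (fun q => ?_) q
      · exact ⟨h0.symm, by simpa [h0] using hD⟩
      · exact hδ q

end PivotChain

section PivotOrder

variable {F : Type*} [Field F] {n : ℕ}

theorem injective_of_pairwise {L U : Matrix (Fin n) (Fin n) F} {l : List (Fin n × Fin n)}
    (hl : l.Pairwise fun x y => L x.1 y.1 = 0 ∧ U y.2 x.2 = 0) (hL : ∀ x ∈ l, L x.1 x.1 ≠ 0)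
    (hU : ∀ x ∈ l, U x.2 x.2 ≠ 0) :
    (Function.Injective fun q => (l.get q).1) ∧ Function.Injective fun q => (l.get q).2 := by
  rw [List.pairwise_iff_get] at hl
  have hlt : ∀ q q' : Fin l.length, q < q' →
      (l.get q).1 ≠ (l.get q').1 ∧ (l.get q).2 ≠ (l.get q').2 := fun q q' h => by
    refine ⟨fun he => hL _ (List.get_mem l q') ?_, fun he => hU _ (List.get_mem l q') ?_⟩
    · have := (hl q q' h).1
      rwa [he] at this
    · have := (hl q q' h).2
      rwa [he] at this
  constructor
  · intro q q' he
    by_contra hne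
    rcases lt_or_gt_of_ne hne with h | h
    · exact (hlt _ _ h).1 he
    · exact (hlt _ _ h).1 he.symm
  · intro q q' he
    by_contra hne
    rcases lt_or_gt_of_ne hne with h | h
    · exact (hlt _ _ h).2 he
    · exact (hlt _ _ h).2 he.symm

theorem isTruncWeightedPerm_of_pairwise {L D U : Matrix (Fin n) (Fin n) F}
    {l : List (Fin n × Fin n)} (hl : l.Pairwise fun x y => L x.1 y.1 = 0 ∧ U y.2 x.2 = 0)
    (hL : ∀ x ∈ l, L x.1 x.1 ≠ 0) (hU : ∀ x ∈ l, U x.2 x.2 ≠ 0)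
    (hD : ∀ i j, D i j ≠ 0 ↔ (i, j) ∈ l) : IsTruncWeightedPerm D := by
  obtain ⟨hs, ht⟩ := injective_of_pairwise hl hL hU
  refine isTruncWeightedPerm_of_injective hs ht fun i j hij => ?_
  obtain ⟨q, hq⟩ := List.get_of_mem ((hD i j).mp hij)
  exact ⟨q, by rw [hq], by rw [hq]⟩

end PivotOrder

/-! ### The invariant of the recursion -/

section Correctness

variable {F : Type*} [Field F] [DecidableEq F] {n : ℕ}

/-- The properties of the output `X` of the procedure for the input `A`, `α` that the recursion
preserves; `l` is the list of the pivot positions in the order of the elimination. -/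
structure Output.Correct (X : Output F n) (A : Matrix (Fin n) (Fin n) F) (α : F)
    (l : List (Fin n × Fin n)) : Prop where
  lower : X.L.IsLowerTriangular
  upper : X.U.IsUpperTriangular
  factor : α • (X.L * X.D * X.U) = A
  left_inv : X.L * X.Dhat * X.M = 1
  right_inv : X.W * X.Dhat * X.U = 1
  dhat : X.Dhat = (α * X.αr⁻¹) • X.D + X.αr⁻¹ • compl X.D
  left_norm : X.L * (1 - rowProj X.D) = 1 - rowProj X.D
  right_norm : (1 - colProj X.D) * X.U = 1 - colProj X.D
  pairwise : l.Pairwise fun x y => X.L x.1 y.1 = 0 ∧ X.U y.2 x.2 = 0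
  mem_iff : ∀ i j, X.D i j ≠ 0 ↔ (i, j) ∈ l
  diag_eq : ∀ x ∈ l, X.U x.2 x.2 = X.L x.1 x.1
  chain : PivotChain X.D X.L α l X.αr

namespace Output.Correct

variable {X : Output F n} {A : Matrix (Fin n) (Fin n) F} {α : F} {l : List (Fin n × Fin n)}

theorem perm (h : X.Correct A α l) : IsTruncWeightedPerm X.D :=
  isTruncWeightedPerm_of_pairwise h.pairwise (fun _ => h.chain.diag_ne_zero)
    (fun x hx => h.diag_eq x hx ▸ h.chain.diag_ne_zero hx) h.mem_iff

theorem isUnit_L (h : X.Correct A α l) : IsUnit X.L := by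
  have := h.left_inv
  rw [mul_assoc] at this
  exact IsUnit.of_mul_eq_one _ this

theorem isUnit_U (h : X.Correct A α l) : IsUnit X.U :=
  IsUnit.of_mul_eq_one_right _ h.right_inv

theorem isUnit_M (h : X.Correct A α l) : IsUnit X.M :=
  IsUnit.of_mul_eq_one_right _ h.left_inv

theorem isUnit_W (h : X.Correct A α l) : IsUnit X.W := by
  have := h.right_inv
  rw [mul_assoc] at this
  exact IsUnit.of_mul_eq_one _ this

theorem L_diag_ne_zero (h : X.Correct A α l) (i : Fin n) : X.L i i ≠ 0 := by
  have := (Matrix.isUnit_iff_isUnit_det _).mp h.isUnit_L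
  rw [Matrix.det_of_isLowerTriangular _ h.lower, isUnit_iff_ne_zero, Finset.prod_ne_zero_iff] at this
  exact this i (Finset.mem_univ i)

theorem U_diag_ne_zero (h : X.Correct A α l) (i : Fin n) : X.U i i ≠ 0 := by
  have := (Matrix.isUnit_iff_isUnit_det _).mp h.isUnit_U
  rw [Matrix.det_of_isUpperTriangular h.upper, isUnit_iff_ne_zero, Finset.prod_ne_zero_iff] at this
  exact this i (Finset.mem_univ i)

/-- Rows of the input that vanish carry no pivots, and `L` is trivial on them. -/
theorem diagonal_mul_of_mul_eq_zero (h : X.Correct A α l) (hα : α ≠ 0) {d : Fin n → F}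
    (hd : Matrix.diagonal d * A = 0) : Matrix.diagonal d * X.L = Matrix.diagonal d ∧
      Matrix.diagonal d * rowProj X.D = 0 ∧ Matrix.diagonal d * X.D = 0 := by
  rw [← h.factor, mul_smul_comm, smul_eq_zero_iff_right hα] at hd
  obtain ⟨h1, h2⟩ :=
    h.perm.diagonal_mul_of_mul_eq_zero h.L_diag_ne_zero h.left_norm h.isUnit_U hd
  refine ⟨h1, h2, ?_⟩
  rw [← h.perm.rowProj_mul, ← mul_assoc, h2, zero_mul]

/-- Columns of the input that vanish carry no pivots, and `U` is trivial on them. -/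
theorem mul_diagonal_of_mul_eq_zero (h : X.Correct A α l) (hα : α ≠ 0) {d : Fin n → F}
    (hd : A * Matrix.diagonal d = 0) : X.U * Matrix.diagonal d = Matrix.diagonal d ∧
      colProj X.D * Matrix.diagonal d = 0 ∧ X.D * Matrix.diagonal d = 0 := by
  rw [← h.factor, smul_mul_assoc, smul_eq_zero_iff_right hα] at hd
  have hd' := congrArg Matrix.transpose hd
  rw [Matrix.transpose_mul, Matrix.transpose_mul, Matrix.transpose_mul, Matrix.diagonal_transpose,
    Matrix.transpose_zero, ← mul_assoc X.U.transpose] at hd'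
  have hn := congrArg Matrix.transpose h.right_norm
  rw [Matrix.transpose_mul, Matrix.transpose_sub, Matrix.transpose_one, transpose_colProj] at hn
  obtain ⟨h1, h2⟩ := h.perm.transpose.diagonal_mul_of_mul_eq_zero (L := X.U.transpose)
    (U := X.L.transpose) h.U_diag_ne_zero hn ((Matrix.isUnit_transpose _).mpr h.isUnit_L) hd'
  have h1' := congrArg Matrix.transpose h1
  have h2' := congrArg Matrix.transpose h2
  rw [Matrix.transpose_mul, Matrix.diagonal_transpose, Matrix.transpose_transpose] at h1'
  rw [Matrix.transpose_mul, Matrix.diagonal_transpose, transpose_rowProj, Matrix.transpose_zero]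
    at h2'
  refine ⟨h1', h2', ?_⟩
  rw [← h.perm.mul_colProj, mul_assoc]
  exact (congrArg _ h2').trans (mul_zero _)

theorem L_mul_of_rowProj_mul (h : X.Correct A α l) {Y : Matrix (Fin n) (Fin n) F}
    (hY : rowProj X.D * Y = 0) : X.L * Y = Y := by
  calc X.L * Y = X.L * (1 - rowProj X.D) * Y + X.L * (rowProj X.D * Y) := by noncomm_ring
    _ = Y := by rw [h.left_norm, hY, sub_mul, hY]; simp

theorem mul_U_of_mul_colProj (h : X.Correct A α l) {Y : Matrix (Fin n) (Fin n) F}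
    (hY : Y * colProj X.D = 0) : Y * X.U = Y := by
  calc Y * X.U = Y * ((1 - colProj X.D) * X.U) + Y * colProj X.D * X.U := by noncomm_ring
    _ = Y := by rw [h.right_norm, hY, mul_sub, hY]; simp

end Output.Correct

theorem zeroOutput_correct (n : ℕ) {α : F} (hα : α ≠ 0) : (zeroOutput n α).Correct 0 α [] where
  lower := Matrix.blockTriangular_one
  upper := Matrix.blockTriangular_one
  factor := by simp [zeroOutput]
  left_inv := by simp [zeroOutput, hα]
  right_inv := by simp [zeroOutput, hα]
  dhat := by
    have : compl (0 : Matrix (Fin n) (Fin n) F) = 1 := by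
      have hr : zeroRows (0 : Matrix (Fin n) (Fin n) F) = Finset.univ := by
        ext; simp [mem_zeroRows]
      have hc : zeroCols (0 : Matrix (Fin n) (Fin n) F) = Finset.univ := by
        ext; simp [mem_zeroCols]
      ext i j
      simp only [compl, Matrix.of_apply, Matrix.one_apply, hr, hc, Finset.mem_univ, true_and]
      refine if_congr ⟨fun h => ?_, fun h => by rw [h]⟩ rfl rfl
      exact card_filter_lt_injOn Finset.univ (Finset.mem_coe.mpr (Finset.mem_univ i))
        (Finset.mem_coe.mpr (Finset.mem_univ j)) h
    simp [zeroOutput, this]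
  left_norm := by simp [zeroOutput]
  right_norm := by simp [zeroOutput]
  pairwise := List.Pairwise.nil
  mem_iff := by simp [zeroOutput]
  diag_eq := by simp
  chain := .nil _

theorem ldu_zero_correct {A : Matrix (Fin (2 ^ 0)) (Fin (2 ^ 0)) F} {α : F} (hα : α ≠ 0)
    (hA : A ≠ 0) : (ldu 0 A α).Correct A α [(0, 0)] := by
  have hfin : ∀ i : Fin (2 ^ 0), i = 0 := fun i => Subsingleton.elim (α := Fin 1) i 0
  have ha : A 0 0 ≠ 0 := fun h0 => hA (by ext i j; rw [hfin i, hfin j, h0]; rfl)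
  have hsum : ∀ f : Fin (2 ^ 0) → F, ∑ i, f i = f 0 := fun f => Fin.sum_univ_one f
  have hone : (1 : Matrix (Fin (2 ^ 0)) (Fin (2 ^ 0)) F) 0 0 = 1 := rfl
  have hext : ∀ B C : Matrix (Fin (2 ^ 0)) (Fin (2 ^ 0)) F, B 0 0 = C 0 0 → B = C :=
    fun B C h => by ext i j; rw [hfin i, hfin j, h]
  rw [ldu, if_neg hA]
  have hinv : (α * A 0 0)⁻¹ ≠ 0 := inv_ne_zero (mul_ne_zero hα ha)
  constructor
  · intro i j hij
    exact absurd hij (by rw [hfin i, hfin j]; exact lt_irrefl _)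
  · intro i j hij
    exact absurd hij (by rw [hfin i, hfin j]; exact lt_irrefl _)
  · refine hext _ _ ?_
    simp only [Matrix.smul_apply, Matrix.mul_apply, hsum, Matrix.of_apply, smul_eq_mul]
    field_simp
  · refine hext _ _ ?_
    simp only [Matrix.mul_apply, hsum, Matrix.of_apply, hone]
    field_simp
  · refine hext _ _ ?_
    simp only [Matrix.mul_apply, hsum, Matrix.of_apply, hone]
    field_simp
  · refine hext _ _ ?_
    have : (0 : Fin (2 ^ 0)) ∉ zeroRows (Matrix.of fun i j => (α * A i j)⁻¹) := by
      rw [mem_zeroRows]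
      exact fun h => hinv (h 0)
    simp only [Matrix.add_apply, Matrix.smul_apply, compl_eq_zero_of_row this, Matrix.of_apply,
      smul_eq_mul]
    field_simp
    simp
  · refine hext _ _ ?_
    simp only [Matrix.mul_apply, hsum, rowProj, unitMap, Matrix.of_apply, Matrix.sub_apply, hone,
      Matrix.transpose_apply, hinv, if_false, mul_one, sub_self, mul_zero]
  · refine hext _ _ ?_
    simp only [Matrix.mul_apply, hsum, colProj, unitMap, Matrix.of_apply, Matrix.sub_apply, hone,
      Matrix.transpose_apply, hinv, if_false, mul_one, sub_self, zero_mul]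
  · exact List.pairwise_singleton _ _
  · intro i j
    rw [hfin i, hfin j]
    simpa using ⟨ha, hα⟩
  · intro x _
    rw [hfin x.1, hfin x.2]
  · exact .cons rfl ha (.nil _)

end Correctness

/-! ### Block matrices -/

section JoinBlocks

variable {F : Type*} {p : ℕ}

/-- The position in the first half of the indices. -/
def lo (i : Fin (2 ^ p)) : Fin (2 ^ (p + 1)) := halves p (Sum.inl i)

/-- The position in the second half of the indices. -/
def hi (i : Fin (2 ^ p)) : Fin (2 ^ (p + 1)) := halves p (Sum.inr i)

theorem forall_halves {P : Fin (2 ^ (p + 1)) → Prop} :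
    (∀ i, P i) ↔ (∀ i : Fin (2 ^ p), P (lo i)) ∧ ∀ i : Fin (2 ^ p), P (hi i) := by
  refine ⟨fun h => ⟨fun i => h _, fun i => h _⟩, fun h i => ?_⟩
  obtain ⟨x, rfl⟩ := (halves p).surjective i
  cases x with
  | inl x => exact h.1 x
  | inr x => exact h.2 x

theorem lo_injective : Function.Injective (lo (p := p)) :=
  (halves p).injective.comp Sum.inl_injective

theorem hi_injective : Function.Injective (hi (p := p)) :=
  (halves p).injective.comp Sum.inr_injective

theorem lo_inj {i j : Fin (2 ^ p)} : lo i = lo j ↔ i = j := lo_injective.eq_iff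

theorem hi_inj {i j : Fin (2 ^ p)} : hi i = hi j ↔ i = j := hi_injective.eq_iff

theorem lo_ne_hi (i j : Fin (2 ^ p)) : lo i ≠ hi j := fun h => by
  have := (halves p).injective h
  simp at this

theorem lo_lt_lo {i j : Fin (2 ^ p)} : lo i < lo j ↔ i < j := Iff.rfl

theorem hi_lt_hi {i j : Fin (2 ^ p)} : hi i < hi j ↔ i < j := by
  rw [Fin.lt_def, Fin.lt_def]
  simp [hi, halves]

theorem lo_lt_hi (i j : Fin (2 ^ p)) : lo i < hi j := by
  rw [Fin.lt_def]
  simp only [lo, hi, halves, Equiv.trans_apply, finSumFinEquiv_apply_left,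
    finSumFinEquiv_apply_right, finCongr_apply, Fin.val_cast, Fin.val_castAdd, Fin.val_natAdd]
  omega

section Apply

variable (A B C D : Matrix (Fin (2 ^ p)) (Fin (2 ^ p)) F) (i j : Fin (2 ^ p))

theorem joinBlocks_lo_lo : joinBlocks A B C D (lo i) (lo j) = A i j := by
  simp [joinBlocks, lo]

theorem joinBlocks_lo_hi : joinBlocks A B C D (lo i) (hi j) = B i j := by
  simp [joinBlocks, lo, hi]

theorem joinBlocks_hi_lo : joinBlocks A B C D (hi i) (lo j) = C i j := by
  simp [joinBlocks, lo, hi]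

theorem joinBlocks_hi_hi : joinBlocks A B C D (hi i) (hi j) = D i j := by
  simp [joinBlocks, hi]

end Apply

theorem joinBlocks_toBlocks (A : Matrix (Fin (2 ^ (p + 1))) (Fin (2 ^ (p + 1))) F) :
    joinBlocks (Matrix.reindex (halves p).symm (halves p).symm A).toBlocks₁₁
      (Matrix.reindex (halves p).symm (halves p).symm A).toBlocks₁₂
      (Matrix.reindex (halves p).symm (halves p).symm A).toBlocks₂₁
      (Matrix.reindex (halves p).symm (halves p).symm A).toBlocks₂₂ = A := by
  rw [joinBlocks, Matrix.fromBlocks_toBlocks]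
  ext i j
  simp

variable [Field F]

theorem joinBlocks_mul (A B C D A' B' C' D' : Matrix (Fin (2 ^ p)) (Fin (2 ^ p)) F) :
    joinBlocks A B C D * joinBlocks A' B' C' D' =
      joinBlocks (A * A' + B * C') (A * B' + B * D') (C * A' + D * C') (C * B' + D * D') := by
  simp only [joinBlocks, Matrix.reindex_apply]
  rw [Matrix.submatrix_mul_equiv, Matrix.fromBlocks_multiply]

theorem smul_joinBlocks (c : F) (A B C D : Matrix (Fin (2 ^ p)) (Fin (2 ^ p)) F) :
    c • joinBlocks A B C D = joinBlocks (c • A) (c • B) (c • C) (c • D) := by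
  rw [joinBlocks, joinBlocks, ← Matrix.fromBlocks_smul]
  rfl

theorem joinBlocks_one : joinBlocks 1 0 0 1 = (1 : Matrix (Fin (2 ^ (p + 1))) (Fin (2 ^ (p + 1))) F) := by
  simp [joinBlocks]

theorem isLowerTriangular_joinBlocks {A C D : Matrix (Fin (2 ^ p)) (Fin (2 ^ p)) F}
    (hA : A.IsLowerTriangular) (hD : D.IsLowerTriangular) :
    (joinBlocks A 0 C D).IsLowerTriangular := by
  have : ∀ i j, i < j → joinBlocks A 0 C D i j = 0 := by
    simp only [forall_halves, joinBlocks_lo_lo, joinBlocks_lo_hi, joinBlocks_hi_lo,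
      joinBlocks_hi_hi, lo_lt_lo, hi_lt_hi]
    exact ⟨fun i => ⟨fun j hij => hA hij, fun _ _ => rfl⟩,
      fun i => ⟨fun j hij => absurd hij (lo_lt_hi j i).asymm, fun j hij => hD hij⟩⟩
  exact fun i j hij => this i j hij

theorem isUpperTriangular_joinBlocks {A B D : Matrix (Fin (2 ^ p)) (Fin (2 ^ p)) F}
    (hA : A.IsUpperTriangular) (hD : D.IsUpperTriangular) :
    (joinBlocks A B 0 D).IsUpperTriangular := by
  have : ∀ i j, j < i → joinBlocks A B 0 D i j = 0 := by
    simp only [forall_halves, joinBlocks_lo_lo, joinBlocks_lo_hi, joinBlocks_hi_lo,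
      joinBlocks_hi_hi, lo_lt_lo, hi_lt_hi]
    exact ⟨fun i => ⟨fun j hij => hA hij, fun j hij => absurd hij (lo_lt_hi i j).asymm⟩,
      fun i => ⟨fun _ _ => rfl, fun j hij => hD hij⟩⟩
  exact fun i j hij => this i j hij

variable [DecidableEq F]

theorem one_sub_rowProj_joinBlocks {A B C D : Matrix (Fin (2 ^ p)) (Fin (2 ^ p)) F} {c : F}
    (hc : c ≠ 0) (hA : IsTruncWeightedPerm A) (hB : IsTruncWeightedPerm B)
    (hC : IsTruncWeightedPerm C) (hD : IsTruncWeightedPerm D)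
    (h : IsTruncWeightedPerm (joinBlocks A (c • B) C D)) :
    1 - rowProj (joinBlocks A (c • B) C D) =
      joinBlocks ((1 - rowProj A) * (1 - rowProj B)) 0 0 ((1 - rowProj C) * (1 - rowProj D)) := by
  have h1 : ∀ i, lo i ∈ zeroRows (joinBlocks A (c • B) C D) ↔ i ∈ zeroRows A ∧ i ∈ zeroRows B := by
    intro i
    simp [mem_zeroRows, forall_halves, joinBlocks_lo_lo, joinBlocks_lo_hi, hc]
  have h2 : ∀ i, hi i ∈ zeroRows (joinBlocks A (c • B) C D) ↔ i ∈ zeroRows C ∧ i ∈ zeroRows D := by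
    intro i
    simp [mem_zeroRows, forall_halves, joinBlocks_hi_lo, joinBlocks_hi_hi]
  rw [h.one_sub_rowProj, hA.one_sub_rowProj, hB.one_sub_rowProj, hC.one_sub_rowProj,
    hD.one_sub_rowProj, Matrix.diagonal_mul_diagonal, Matrix.diagonal_mul_diagonal,
    ← Matrix.ext_iff]
  simp only [forall_halves, joinBlocks_lo_lo, joinBlocks_lo_hi, joinBlocks_hi_lo,
    joinBlocks_hi_hi, Matrix.diagonal_apply, lo_inj, hi_inj, lo_ne_hi, (lo_ne_hi _ _).symm, h1, h2,
    if_false, Matrix.zero_apply, mul_ite, mul_one, mul_zero, ite_and]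
  refine ⟨fun i => ⟨fun j => ?_, fun j => trivial⟩, fun i => ⟨fun j => trivial, fun j => ?_⟩⟩ <;>
  split_ifs <;> rfl

theorem one_sub_colProj_joinBlocks {A B C D : Matrix (Fin (2 ^ p)) (Fin (2 ^ p)) F} {c : F}
    (hc : c ≠ 0) (hA : IsTruncWeightedPerm A) (hB : IsTruncWeightedPerm B)
    (hC : IsTruncWeightedPerm C) (hD : IsTruncWeightedPerm D)
    (h : IsTruncWeightedPerm (joinBlocks A (c • B) C D)) :
    1 - colProj (joinBlocks A (c • B) C D) =
      joinBlocks ((1 - colProj A) * (1 - colProj C)) 0 0 ((1 - colProj B) * (1 - colProj D)) := by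
  have h1 : ∀ i, lo i ∈ zeroCols (joinBlocks A (c • B) C D) ↔ i ∈ zeroCols A ∧ i ∈ zeroCols C := by
    intro i
    simp [mem_zeroCols, forall_halves, joinBlocks_lo_lo, joinBlocks_hi_lo]
  have h2 : ∀ i, hi i ∈ zeroCols (joinBlocks A (c • B) C D) ↔ i ∈ zeroCols B ∧ i ∈ zeroCols D := by
    intro i
    simp [mem_zeroCols, forall_halves, joinBlocks_lo_hi, joinBlocks_hi_hi, hc]
  rw [h.one_sub_colProj, hA.one_sub_colProj, hB.one_sub_colProj, hC.one_sub_colProj,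
    hD.one_sub_colProj, Matrix.diagonal_mul_diagonal, Matrix.diagonal_mul_diagonal,
    ← Matrix.ext_iff]
  simp only [forall_halves, joinBlocks_lo_lo, joinBlocks_lo_hi, joinBlocks_hi_lo,
    joinBlocks_hi_hi, Matrix.diagonal_apply, lo_inj, hi_inj, lo_ne_hi, (lo_ne_hi _ _).symm, h1, h2,
    if_false, Matrix.zero_apply, mul_ite, mul_one, mul_zero, ite_and]
  refine ⟨fun i => ⟨fun j => ?_, fun j => trivial⟩, fun i => ⟨fun j => trivial, fun j => ?_⟩⟩ <;>
  split_ifs <;> rfl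

end JoinBlocks

section Weight

variable {F : Type*} [Field F] {n : ℕ} {P Y : Matrix (Fin n) (Fin n) F}

theorem weight_mul_weight_inv {c : F} (hc : c ≠ 0) (hP : P * P = P) :
    weight c P * weight c⁻¹ P = 1 := by
  simp only [weight, add_mul, mul_add, mul_sub, sub_mul, smul_mul_assoc, mul_smul_comm, hP,
    mul_one, one_mul, sub_self]
  simp [smul_smul, hc]

theorem weight_mul_of_mul_eq_zero (c : F) (h : P * Y = 0) : weight c P * Y = Y := by
  simp [weight, add_mul, sub_mul, h]

theorem weight_mul_of_mul_eq_self (c : F) (h : P * Y = Y) : weight c P * Y = c • Y := by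
  simp [weight, add_mul, sub_mul, h]

theorem mul_weight_of_mul_eq_zero (c : F) (h : Y * P = 0) : Y * weight c P = Y := by
  simp [weight, mul_add, mul_sub, h]

theorem mul_weight_of_mul_eq_self (c : F) (h : Y * P = Y) : Y * weight c P = c • Y := by
  simp [weight, mul_add, mul_sub, h]

theorem blockTriangular_weight {β : Type*} [Preorder β] {b : Fin n → β} (c : F) {d : Fin n → F} :
    (weight c (Matrix.diagonal d)).BlockTriangular b := by
  rw [weight, ← Matrix.diagonal_one, Matrix.diagonal_sub, ← Matrix.diagonal_smul,
    Matrix.diagonal_add]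
  exact Matrix.blockTriangular_diagonal _

end Weight

/-! ### Block elimination in an algebra -/

section BlockIdentities

variable {F S : Type*} [Field F] [Ring S] [Algebra F S]

theorem mul_mul_eq_of_mul_eq {a b c : S} (h : a * b = c) (x : S) : a * (b * x) = c * x := by
  rw [← mul_assoc, h]

/-- The upper right block: the first recursive call reproduces the pivot rows of `A₁₂`, the call
for `A₁₂_2` the other rows. -/
theorem smul_blocks_eq_A₁₂ {α κ lam : F} (hα : α ≠ 0) (hκ : κ ≠ 0) (hlam : lam ≠ 0)
    {A L₁ D₁ Dc M₁ L₂ D₂ U₂ V T w v : S}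
    (h1 : L₁ * ((α * κ⁻¹) • D₁ + κ⁻¹ • Dc) * M₁ = 1)
    (h2 : κ • (L₂ * D₂ * U₂) = α⁻¹ • (Dc * (M₁ * A)))
    (hw : w * D₁ = D₁) (hL : L₂ * D₁ = D₁) (hV : D₁ * V = κ⁻¹ • (D₁ * M₁ * A))
    (hwD : w * D₂ = lam • D₂) (hDT : D₂ * T = D₂) (hDv : D₂ * v = lam • D₂) :
    α • (L₁ * (L₂ * w) * D₁ * V + L₁ * (L₂ * w) * ((lam ^ 2)⁻¹ • D₂) * (T * (v * U₂))) = A := by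
  have e1 : L₁ * (L₂ * w) * D₁ * V = κ⁻¹ • (L₁ * D₁ * M₁ * A) := by
    rw [mul_assoc _ D₁ V, hV, mul_smul_comm]
    simp only [mul_assoc, mul_mul_eq_of_mul_eq hw, mul_mul_eq_of_mul_eq hL]
  have e2 : L₁ * (L₂ * w) * ((lam ^ 2)⁻¹ • D₂) * (T * (v * U₂)) = L₁ * (L₂ * D₂ * U₂) := by
    simp only [mul_assoc, mul_smul_comm, smul_mul_assoc, mul_mul_eq_of_mul_eq hDT,
      mul_mul_eq_of_mul_eq hDv, mul_mul_eq_of_mul_eq hwD, smul_smul]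
    rw [show (lam ^ 2)⁻¹ * (lam * lam) = 1 by field_simp, one_smul]
  have e3 : L₂ * D₂ * U₂ = (κ⁻¹ * α⁻¹) • (Dc * (M₁ * A)) := by
    rw [mul_smul, ← h2, smul_smul, inv_mul_cancel₀ hκ, one_smul]
  have e4 : (α * κ⁻¹) • (L₁ * D₁ * M₁ * A) + κ⁻¹ • (L₁ * (Dc * (M₁ * A))) = A := by
    calc _ = L₁ * ((α * κ⁻¹) • D₁ + κ⁻¹ • Dc) * M₁ * A := by
          simp only [mul_add, add_mul, mul_smul_comm, smul_mul_assoc, mul_assoc]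
      _ = A := by rw [h1, one_mul]
  rw [e1, e2, e3, mul_smul_comm, smul_add, smul_smul, smul_smul,
    show α * (κ⁻¹ * α⁻¹) = κ⁻¹ by field_simp]
  exact e4

/-- The lower left block: the first recursive call reproduces the pivot columns of `A₂₁`, the
call for `A₂₁_2` the other columns. -/
theorem smul_blocks_eq_A₂₁ {α κ : F} (hα : α ≠ 0) (hκ : κ ≠ 0)
    {A W₁ D₁ Dc U₁ L₂ D₂ U₂ C N : S}
    (h1 : W₁ * ((α * κ⁻¹) • D₁ + κ⁻¹ • Dc) * U₁ = 1)
    (h2 : κ • (L₂ * D₂ * U₂) = α⁻¹ • (A * W₁ * Dc))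
    (hC : C * D₁ = κ⁻¹ • (A * W₁ * D₁)) (hDU : D₁ * U₂ = D₁) (hN : N * D₂ = D₂) :
    α • ((C * D₁ + L₂ * N * D₂) * (U₂ * U₁)) = A := by
  have e1 : C * D₁ * (U₂ * U₁) = κ⁻¹ • (A * W₁ * D₁ * U₁) := by
    rw [hC, smul_mul_assoc]
    simp only [mul_assoc, mul_mul_eq_of_mul_eq hDU]
  have e2 : L₂ * N * D₂ * (U₂ * U₁) = (κ⁻¹ * α⁻¹) • (A * W₁ * Dc * U₁) := by
    rw [mul_assoc L₂, hN, ← mul_assoc, ← smul_mul_assoc, mul_smul, ← h2, smul_smul,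
      inv_mul_cancel₀ hκ, one_smul]
  rw [add_mul, e1, e2, smul_add, smul_smul, smul_smul, show α * (κ⁻¹ * α⁻¹) = κ⁻¹ by field_simp]
  calc _ = A * (W₁ * ((α * κ⁻¹) • D₁ + κ⁻¹ • Dc) * U₁) := by
        simp only [mul_add, add_mul, mul_smul_comm, smul_mul_assoc, mul_assoc]
    _ = A := by rw [h1, mul_one]

/-- The lower right block: `A₂₂_1` is the Schur complement after the first call, and the other
three calls reproduce it. -/
theorem smul_blocks_eq_A₂₂ {α κ μ ν : F} (hα : α ≠ 0) (hκ : κ ≠ 0) (hμ : μ ≠ 0) (hν : ν ≠ 0)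
    {A A₁₂ A₂₁ E L₂ D₂ Dc₂ M₂ W₃ D₃ Dc₃ U₃ L₄ D₄ U₄ W₁ D₁ M₁ C V v : S}
    (hE : (α * κ) • E = (α * κ ^ 2) • A - α ^ 2 • (A₂₁ * W₁ * D₁ * M₁ * A₁₂))
    (h2 : L₂ * ((κ * μ⁻¹) • D₂ + μ⁻¹ • Dc₂) * M₂ = 1)
    (h3 : W₃ * ((κ * ν⁻¹) • D₃ + ν⁻¹ • Dc₃) * U₃ = 1)
    (h4 : (μ / κ * ν) • (L₄ * D₄ * U₄) = (κ ^ 2 * α)⁻¹ • (Dc₂ * M₂ * E * W₃ * Dc₃))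
    (hC₁ : C * D₁ = κ⁻¹ • (A₂₁ * W₁ * D₁))
    (hC₃ : C * D₃ = (ν * κ * α)⁻¹ • (Dc₂ * M₂ * E * W₃ * D₃))
    (hV₁ : D₁ * V = κ⁻¹ • (D₁ * M₁ * A₁₂)) (hV₂ : D₂ * V = (μ * α)⁻¹ • (D₂ * M₂ * E))
    (hL₄ : L₄ * D₂ = D₂) (hU₄ : D₃ * U₄ = D₃) (hv₃ : D₃ * v = (μ / κ) • D₃)
    (hv₄ : D₄ * (U₄ * v) = D₄ * U₄) (hL₂ : L₂ * Dc₂ = Dc₂) :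
    α • ((C * D₁ + L₂ * L₄ * D₂) * V +
      (C * (((μ / κ) ^ 2)⁻¹ • D₃) + L₂ * L₄ * D₄) * (U₄ * (v * U₃))) = A := by
  have e1 : C * D₁ * V = (κ⁻¹ * κ⁻¹) • (A₂₁ * W₁ * D₁ * M₁ * A₁₂) := by
    rw [mul_assoc, hV₁, mul_smul_comm, ← mul_assoc, ← mul_assoc, hC₁, smul_mul_assoc,
      smul_mul_assoc, smul_smul]
  have e2 : L₂ * L₄ * D₂ * V = (μ * α)⁻¹ • (L₂ * D₂ * M₂ * E) := by
    rw [mul_assoc L₂, hL₄, mul_assoc, hV₂, mul_smul_comm]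
    simp only [mul_assoc]
  have e3 : C * (((μ / κ) ^ 2)⁻¹ • D₃) * (U₄ * (v * U₃)) =
      (((μ / κ) ^ 2)⁻¹ * ((μ / κ) * (ν * κ * α)⁻¹)) • (Dc₂ * M₂ * E * W₃ * D₃ * U₃) := by
    rw [mul_smul_comm, smul_mul_assoc, mul_assoc C, mul_mul_eq_of_mul_eq hU₄,
      mul_mul_eq_of_mul_eq hv₃, smul_mul_assoc, mul_smul_comm, ← mul_assoc C, hC₃, smul_mul_assoc,
      smul_smul, smul_smul, mul_assoc]
  have e4 : L₂ * L₄ * D₄ * (U₄ * (v * U₃)) =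
      ((μ / κ * ν)⁻¹ * (κ ^ 2 * α)⁻¹) • (Dc₂ * M₂ * E * W₃ * Dc₃ * U₃) := by
    have h0 : μ / κ * ν ≠ 0 := mul_ne_zero (div_ne_zero hμ hκ) hν
    have h4' : L₄ * D₄ * U₄ = ((μ / κ * ν)⁻¹ * (κ ^ 2 * α)⁻¹) • (Dc₂ * M₂ * E * W₃ * Dc₃) := by
      rw [mul_smul, ← h4, smul_smul, inv_mul_cancel₀ h0, one_smul]
    calc L₂ * L₄ * D₄ * (U₄ * (v * U₃)) = L₂ * (L₄ * (D₄ * (U₄ * v))) * U₃ := by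
          simp only [mul_assoc]
      _ = L₂ * (L₄ * D₄ * U₄) * U₃ := by rw [hv₄, ← mul_assoc L₄]
      _ = _ := by
          rw [h4', mul_smul_comm, smul_mul_assoc]
          simp only [mul_assoc, mul_mul_eq_of_mul_eq hL₂]
  have e5 : (κ * ν⁻¹) • (Dc₂ * M₂ * E * W₃ * D₃ * U₃) + ν⁻¹ • (Dc₂ * M₂ * E * W₃ * Dc₃ * U₃) =
      Dc₂ * M₂ * E := by
    calc _ = Dc₂ * M₂ * E * (W₃ * ((κ * ν⁻¹) • D₃ + ν⁻¹ • Dc₃) * U₃) := by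
          simp only [mul_add, add_mul, mul_smul_comm, smul_mul_assoc, mul_assoc]
      _ = _ := by rw [h3, mul_one]
  have e6 : (κ * μ⁻¹) • (L₂ * D₂ * M₂ * E) + μ⁻¹ • (Dc₂ * M₂ * E) = E := by
    calc _ = L₂ * ((κ * μ⁻¹) • D₂ + μ⁻¹ • Dc₂) * M₂ * E := by
          simp only [mul_add, add_mul, mul_smul_comm, smul_mul_assoc, hL₂]
      _ = _ := by rw [h2, one_mul]
  rw [add_mul, add_mul, e1, e2, e3, e4]
  have e7 : A = (α * κ ^ 2)⁻¹ •
      ((α * κ) • E + α ^ 2 • (A₂₁ * W₁ * D₁ * M₁ * A₁₂)) := by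
    rw [hE, sub_add_cancel, smul_smul, inv_mul_cancel₀ (by positivity), one_smul]
  generalize L₂ * D₂ * M₂ * E = x at e6 ⊢
  generalize Dc₂ * M₂ * E * W₃ * D₃ * U₃ = y at e5 ⊢
  generalize Dc₂ * M₂ * E * W₃ * Dc₃ * U₃ = z at e5 ⊢
  generalize Dc₂ * M₂ * E = u at e5 e6
  rw [e7, ← e6, ← e5]
  match_scalars <;> field_simp

end BlockIdentities

/-! ### Combining the four recursive calls -/

section Idempotents

variable {S : Type*} [Ring S] {P Q : S}

theorem mul_one_sub_mul_one_sub_left (hP : P * P = P) : P * ((1 - P) * (1 - Q)) = 0 := by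
  rw [← mul_assoc, mul_sub P, mul_one, hP, sub_self, zero_mul]

theorem mul_one_sub_mul_one_sub_right (hQ : Q * Q = Q) (hQP : Q * P = 0) :
    Q * ((1 - P) * (1 - Q)) = 0 := by
  rw [← mul_assoc, mul_sub Q 1 P, mul_one, hQP, sub_zero, mul_sub, mul_one, hQ, sub_self]

theorem one_sub_mul_one_sub_mul_right (hQ : Q * Q = Q) : (1 - P) * (1 - Q) * Q = 0 := by
  rw [mul_assoc, sub_mul 1 Q, one_mul, hQ, sub_self, mul_zero]

theorem one_sub_mul_one_sub_mul_left (hP : P * P = P) (hQP : Q * P = 0) :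
    (1 - P) * (1 - Q) * P = 0 := by
  rw [mul_assoc, sub_mul 1 Q, one_mul, hQP, sub_zero, sub_mul, one_mul, hP, sub_self]

end Idempotents

section Combine

variable {F : Type*} [Field F] [DecidableEq F] {p : ℕ}

/-- The argument `A₁₂²` of the recursive call for the upper right block. -/
def input₁₂ (α : F) (X₁₁ : Output F (2 ^ p)) (A₁₂ : Matrix (Fin (2 ^ p)) (Fin (2 ^ p)) F) :
    Matrix (Fin (2 ^ p)) (Fin (2 ^ p)) F :=
  α⁻¹ • (compl X₁₁.D * (X₁₁.M * A₁₂))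

/-- The argument `A₂₁²` of the recursive call for the lower left block. -/
def input₂₁ (α : F) (X₁₁ : Output F (2 ^ p)) (A₂₁ : Matrix (Fin (2 ^ p)) (Fin (2 ^ p)) F) :
    Matrix (Fin (2 ^ p)) (Fin (2 ^ p)) F :=
  α⁻¹ • (A₂₁ * X₁₁.W * compl X₁₁.D)

/-- The matrix `A₂₂¹`, a multiple of what is left of `A₂₂` after the elimination with the pivots
in the upper left block. -/
noncomputable def remainder₂₂ (α : F) (X₁₁ : Output F (2 ^ p))
    (A₁₂ A₂₁ A₂₂ : Matrix (Fin (2 ^ p)) (Fin (2 ^ p)) F) : Matrix (Fin (2 ^ p)) (Fin (2 ^ p)) F :=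
  (α * X₁₁.αr)⁻¹ • ((α * X₁₁.αr ^ 2) • A₂₂ -
    (X₁₁.αr • (A₂₁ * X₁₁.W * X₁₁.Dhat)) * pinv X₁₁.D * (X₁₁.αr • (X₁₁.Dhat * (X₁₁.M * A₁₂))))

/-- The argument `A₂₂³` of the recursive call for the lower right block. -/
noncomputable def input₂₂ (α : F) (X₁₁ X₂₁ X₁₂ : Output F (2 ^ p))
    (A₁₂ A₂₁ A₂₂ : Matrix (Fin (2 ^ p)) (Fin (2 ^ p)) F) : Matrix (Fin (2 ^ p)) (Fin (2 ^ p)) F :=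
  (X₁₁.αr ^ 2 * α)⁻¹ •
    (compl X₂₁.D * X₂₁.M * remainder₂₂ α X₁₁ A₁₂ A₂₁ A₂₂ * X₁₂.W * compl X₁₂.D)

/-- The lower left block `L₃` of `L`. -/
noncomputable def lowerLeft (α : F) (X₁₁ X₂₁ X₁₂ : Output F (2 ^ p))
    (A₁₂ A₂₁ A₂₂ : Matrix (Fin (2 ^ p)) (Fin (2 ^ p)) F) : Matrix (Fin (2 ^ p)) (Fin (2 ^ p)) F :=
  X₁₁.αr⁻¹ • (A₂₁ * X₁₁.W * rowProj X₁₁.D) + (X₁₂.αr * X₁₁.αr * α)⁻¹ •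
    (compl X₂₁.D * X₂₁.M * remainder₂₂ α X₁₁ A₁₂ A₂₁ A₂₂ * X₁₂.W * rowProj X₁₂.D)

/-- The upper right block `U₂` of `U`. -/
noncomputable def upperRight (α : F) (X₁₁ X₂₁ : Output F (2 ^ p))
    (A₁₂ A₂₁ A₂₂ : Matrix (Fin (2 ^ p)) (Fin (2 ^ p)) F) : Matrix (Fin (2 ^ p)) (Fin (2 ^ p)) F :=
  X₁₁.αr⁻¹ • (colProj X₁₁.D * X₁₁.M * A₁₂) + (X₂₁.αr * α)⁻¹ •
    (colProj X₂₁.D * X₂₁.M * remainder₂₂ α X₁₁ A₁₂ A₂₁ A₂₂)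

/-- The output of the procedure in terms of the outputs of the four recursive calls, with `V` in
place of `U₂` and `C` in place of `L₃`. -/
noncomputable def combine (α : F) (X₁₁ X₂₁ X₁₂ X₂₂ : Output F (2 ^ p))
    (C V : Matrix (Fin (2 ^ p)) (Fin (2 ^ p)) F) : Output F (2 ^ (p + 1)) :=
  let lam := X₂₁.αr / X₁₁.αr
  let D := joinBlocks X₁₁.D ((lam ^ 2)⁻¹ • X₁₂.D) X₂₁.D X₂₂.D
  let Dhat := (α * X₂₂.αr⁻¹) • D + X₂₂.αr⁻¹ • compl D
  let P₁ := weight lam⁻¹ (rowProj X₁₂.D) * X₁₂.Dhat * X₁₂.M * X₁₁.Dhat * X₁₁.M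
  let P₄ := X₂₂.Dhat * X₂₂.M * X₂₁.Dhat * X₂₁.M
  let Q₁ := X₁₁.W * X₁₁.Dhat * X₂₁.W * X₂₁.Dhat
  let Q₄ := X₁₂.W * X₁₂.Dhat * weight lam⁻¹ (colProj X₁₂.D) * X₂₂.W * X₂₂.Dhat
  { L := joinBlocks (X₁₁.L * (X₁₂.L * weight lam (rowProj X₁₂.D))) 0 C (X₂₁.L * X₂₂.L)
    D := D
    U := joinBlocks (X₂₁.U * X₁₁.U) V 0 (X₂₂.U * (weight lam (colProj X₁₂.D) * X₁₂.U))
    M := Dhat⁻¹ * joinBlocks P₁ 0 (-(P₄ * C * P₁)) P₄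
    Dhat := Dhat
    W := joinBlocks Q₁ (-(Q₁ * V * Q₄)) 0 Q₄ * Dhat⁻¹
    αr := X₂₂.αr }

/-- The pivots of the four blocks in the order of the elimination. -/
def joinPivots (l₁₁ l₂₁ l₁₂ l₂₂ : List (Fin (2 ^ p) × Fin (2 ^ p))) :
    List (Fin (2 ^ (p + 1)) × Fin (2 ^ (p + 1))) :=
  l₁₁.map (Prod.map lo lo) ++ (l₂₁.map (Prod.map hi lo) ++
    (l₁₂.map (Prod.map lo hi) ++ l₂₂.map (Prod.map hi hi)))

theorem rowProj_comm {n : ℕ} {D D' : Matrix (Fin n) (Fin n) F} (h : IsTruncWeightedPerm D)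
    (h' : IsTruncWeightedPerm D') : rowProj D * rowProj D' = rowProj D' * rowProj D := by
  rw [h.rowProj_eq, h'.rowProj_eq, Matrix.diagonal_mul_diagonal, Matrix.diagonal_mul_diagonal]
  simp only [mul_comm]

theorem colProj_comm {n : ℕ} {D D' : Matrix (Fin n) (Fin n) F} (h : IsTruncWeightedPerm D)
    (h' : IsTruncWeightedPerm D') : colProj D * colProj D' = colProj D' * colProj D :=
  rowProj_comm h.transpose h'.transpose

/-- Relations between the outputs of two calls where the input of the second has no nonzero
entries in the pivot rows of the first. -/
structure RowsDisjoint {n : ℕ} (X Y : Output F n) : Prop where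
  proj_mul_L : rowProj X.D * Y.L = rowProj X.D
  proj_mul_proj : rowProj X.D * rowProj Y.D = 0
  proj_mul_proj' : rowProj Y.D * rowProj X.D = 0
  proj_mul_D : rowProj X.D * Y.D = 0
  proj_mul_D' : rowProj Y.D * X.D = 0
  L_mul_D : Y.L * X.D = X.D

theorem RowsDisjoint.of_mul_eq_zero {n : ℕ} {X Y : Output F n} {A B : Matrix (Fin n) (Fin n) F}
    {α β : F} {l l' : List (Fin n × Fin n)} (hX : X.Correct A α l) (hY : Y.Correct B β l')
    (hβ : β ≠ 0) (h : rowProj X.D * B = 0) : RowsDisjoint X Y := by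
  have h' := h
  rw [hX.perm.rowProj_eq] at h'
  obtain ⟨h1, h2, h3⟩ := hY.diagonal_mul_of_mul_eq_zero hβ h'
  rw [← hX.perm.rowProj_eq] at h1 h2 h3
  have h4 : rowProj Y.D * rowProj X.D = 0 := by rw [rowProj_comm hY.perm hX.perm, h2]
  have h5 : rowProj Y.D * X.D = 0 := by rw [← hX.perm.rowProj_mul, ← mul_assoc, h4, zero_mul]
  exact ⟨h1, h2, h4, h3, h5, hY.L_mul_of_rowProj_mul h5⟩

/-- Relations between the outputs of two calls where the input of the second has no nonzero
entries in the pivot columns of the first. -/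
structure ColsDisjoint {n : ℕ} (X Y : Output F n) : Prop where
  U_mul_proj : Y.U * colProj X.D = colProj X.D
  proj_mul_proj : colProj Y.D * colProj X.D = 0
  proj_mul_proj' : colProj X.D * colProj Y.D = 0
  D_mul_proj : Y.D * colProj X.D = 0
  D_mul_proj' : X.D * colProj Y.D = 0
  D_mul_U : X.D * Y.U = X.D

theorem ColsDisjoint.of_mul_eq_zero {n : ℕ} {X Y : Output F n} {A B : Matrix (Fin n) (Fin n) F}
    {α β : F} {l l' : List (Fin n × Fin n)} (hX : X.Correct A α l) (hY : Y.Correct B β l')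
    (hβ : β ≠ 0) (h : B * colProj X.D = 0) : ColsDisjoint X Y := by
  have h' := h
  rw [hX.perm.colProj_eq] at h'
  obtain ⟨h1, h2, h3⟩ := hY.mul_diagonal_of_mul_eq_zero hβ h'
  rw [← hX.perm.colProj_eq] at h1 h2 h3
  have h4 : colProj X.D * colProj Y.D = 0 := by rw [colProj_comm hX.perm hY.perm, h2]
  have h5 : X.D * colProj Y.D = 0 := by rw [← hX.perm.mul_colProj, mul_assoc, h4, mul_zero]
  exact ⟨h1, h2, h4, h3, h5, hY.mul_U_of_mul_colProj h5⟩

/-- The relations between the outputs of the four recursive calls and the blocks `C` of `L` and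
`V` of `U` on which the shape of the result depends. -/
structure Compatible (X₁₁ X₂₁ X₁₂ X₂₂ : Output F (2 ^ p))
    (C V : Matrix (Fin (2 ^ p)) (Fin (2 ^ p)) F) : Prop where
  upper : RowsDisjoint X₁₁ X₁₂
  lower : RowsDisjoint X₂₁ X₂₂
  left : ColsDisjoint X₁₁ X₂₁
  right : ColsDisjoint X₁₂ X₂₂
  C_mul : C * ((1 - rowProj X₁₁.D) * (1 - rowProj X₁₂.D)) = 0
  mul_C_mul : rowProj X₂₁.D * C * rowProj X₁₂.D = 0
  mul_V : (1 - colProj X₁₁.D) * (1 - colProj X₂₁.D) * V = 0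

section Shape

variable {α : F} {X₁₁ X₂₁ X₁₂ X₂₂ : Output F (2 ^ p)}
  {C V A₁₁ A₂₁ A₁₂ A₂₂ : Matrix (Fin (2 ^ p)) (Fin (2 ^ p)) F} {κ σ : F}
  {l₁₁ l₂₁ l₁₂ l₂₂ : List (Fin (2 ^ p) × Fin (2 ^ p))}

theorem apply_eq_of_mul_rowProj {n : ℕ} {D X Y : Matrix (Fin n) (Fin n) F}
    (hD : IsTruncWeightedPerm D) (h : X * rowProj D = Y * rowProj D) {i j k : Fin n}
    (hj : D j k ≠ 0) : X i j = Y i j := by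
  have := congrFun (congrFun h i) j
  have hj' : j ∉ zeroRows D := fun hz => hj (mem_zeroRows.mp hz k)
  rwa [hD.mul_rowProj_apply, hD.mul_rowProj_apply, if_neg hj', if_neg hj'] at this

theorem apply_eq_of_colProj_mul {n : ℕ} {D X Y : Matrix (Fin n) (Fin n) F}
    (hD : IsTruncWeightedPerm D) (h : colProj D * X = colProj D * Y) {i j k : Fin n}
    (hi : D k i ≠ 0) : X i j = Y i j := by
  have := congrFun (congrFun h i) j
  have hi' : i ∉ zeroCols D := fun hz => hi (mem_zeroCols.mp hz k)
  rwa [hD.colProj_mul_apply, hD.colProj_mul_apply, if_neg hi', if_neg hi'] at this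

theorem apply_eq_zero_of_rowProj_mul {n : ℕ} {D D' X : Matrix (Fin n) (Fin n) F}
    (hD : IsTruncWeightedPerm D) (hD' : IsTruncWeightedPerm D')
    (h : rowProj D * X * rowProj D' = 0) {i j k k' : Fin n}
    (hi : D i k ≠ 0) (hj : D' j k' ≠ 0) : X i j = 0 := by
  have := congrFun (congrFun h i) j
  have hi' : i ∉ zeroRows D := fun hz => hi (mem_zeroRows.mp hz k)
  have hj' : j ∉ zeroRows D' := fun hz => hj (mem_zeroRows.mp hz k')
  rwa [hD'.mul_rowProj_apply, if_neg hj', hD.rowProj_mul_apply, if_neg hi'] at this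

theorem apply_eq_zero_of_colProj_mul {n : ℕ} {D D' X : Matrix (Fin n) (Fin n) F}
    (hD : IsTruncWeightedPerm D) (hD' : IsTruncWeightedPerm D')
    (h : colProj D * X * colProj D' = 0) {i j k k' : Fin n}
    (hi : D k i ≠ 0) (hj : D' k' j ≠ 0) : X i j = 0 := by
  have := congrFun (congrFun h i) j
  have hi' : i ∉ zeroCols D := fun hz => hi (mem_zeroCols.mp hz k)
  have hj' : j ∉ zeroCols D' := fun hz => hj (mem_zeroCols.mp hz k')
  rwa [hD'.mul_colProj_apply, if_neg hj', hD.colProj_mul_apply, if_neg hi'] at this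

theorem isLowerTriangular_combine (h₁₁ : X₁₁.Correct A₁₁ α l₁₁) (h₂₁ : X₂₁.Correct A₂₁ κ l₂₁)
    (h₁₂ : X₁₂.Correct A₁₂ κ l₁₂) (h₂₂ : X₂₂.Correct A₂₂ σ l₂₂) :
    (combine α X₁₁ X₂₁ X₁₂ X₂₂ C V).L.IsLowerTriangular := by
  refine isLowerTriangular_joinBlocks (h₁₁.lower.mul (h₁₂.lower.mul ?_)) (h₂₁.lower.mul h₂₂.lower)
  rw [h₁₂.perm.rowProj_eq]
  exact blockTriangular_weight _

theorem isUpperTriangular_combine (h₁₁ : X₁₁.Correct A₁₁ α l₁₁) (h₂₁ : X₂₁.Correct A₂₁ κ l₂₁)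
    (h₁₂ : X₁₂.Correct A₁₂ κ l₁₂) (h₂₂ : X₂₂.Correct A₂₂ σ l₂₂) :
    (combine α X₁₁ X₂₁ X₁₂ X₂₂ C V).U.IsUpperTriangular := by
  refine isUpperTriangular_joinBlocks (h₂₁.upper.mul h₁₁.upper) (h₂₂.upper.mul (.mul ?_ h₁₂.upper))
  rw [h₁₂.perm.colProj_eq]
  exact blockTriangular_weight _

/-- In the pivot columns of `X₁₁`, the upper left block of `L` is that of `X₁₁`. -/
theorem Compatible.L₁₁_mul_rowProj₁₁ (hc : Compatible X₁₁ X₂₁ X₁₂ X₂₂ C V) (lam : F)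
    (h₁₂ : X₁₂.Correct A₁₂ κ l₁₂) :
    X₁₁.L * (X₁₂.L * weight lam (rowProj X₁₂.D)) * rowProj X₁₁.D = X₁₁.L * rowProj X₁₁.D := by
  rw [mul_assoc, mul_assoc, weight_mul_of_mul_eq_zero _ hc.upper.proj_mul_proj',
    h₁₂.L_mul_of_rowProj_mul hc.upper.proj_mul_proj']

/-- In the pivot columns of `X₁₂`, the upper left block of `L` is a multiple of that of `X₁₂`. -/
theorem Compatible.L₁₁_mul_rowProj₁₂ (hc : Compatible X₁₁ X₂₁ X₁₂ X₂₂ C V) (lam : F)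
    (h₁₁ : X₁₁.Correct A₁₁ α l₁₁) (h₁₂ : X₁₂.Correct A₁₂ κ l₁₂) :
    X₁₁.L * (X₁₂.L * weight lam (rowProj X₁₂.D)) * rowProj X₁₂.D =
      (lam • X₁₂.L) * rowProj X₁₂.D := by
  rw [mul_assoc, mul_assoc, weight_mul_of_mul_eq_self _ h₁₂.perm.rowProj_mul_rowProj,
    mul_smul_comm, mul_smul_comm, h₁₁.L_mul_of_rowProj_mul, smul_mul_assoc]
  rw [← mul_assoc, hc.upper.proj_mul_L, hc.upper.proj_mul_proj]

theorem Compatible.L₂₂_mul_rowProj₂₁ (hc : Compatible X₁₁ X₂₁ X₁₂ X₂₂ C V)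
    (h₂₂ : X₂₂.Correct A₂₂ σ l₂₂) :
    X₂₁.L * X₂₂.L * rowProj X₂₁.D = X₂₁.L * rowProj X₂₁.D := by
  rw [mul_assoc, h₂₂.L_mul_of_rowProj_mul hc.lower.proj_mul_proj']

theorem Compatible.L₂₂_mul_rowProj₂₂ (hc : Compatible X₁₁ X₂₁ X₁₂ X₂₂ C V)
    (h₂₁ : X₂₁.Correct A₂₁ κ l₂₁) :
    X₂₁.L * X₂₂.L * rowProj X₂₂.D = X₂₂.L * rowProj X₂₂.D := by
  rw [mul_assoc, h₂₁.L_mul_of_rowProj_mul]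
  rw [← mul_assoc, hc.lower.proj_mul_L, hc.lower.proj_mul_proj]

theorem Compatible.colProj₁₁_mul_U₁₁ (hc : Compatible X₁₁ X₂₁ X₁₂ X₂₂ C V)
    (h₂₁ : X₂₁.Correct A₂₁ κ l₂₁) :
    colProj X₁₁.D * (X₂₁.U * X₁₁.U) = colProj X₁₁.D * X₁₁.U := by
  rw [← mul_assoc, h₂₁.mul_U_of_mul_colProj hc.left.proj_mul_proj']

theorem Compatible.colProj₂₁_mul_U₁₁ (hc : Compatible X₁₁ X₂₁ X₁₂ X₂₂ C V)
    (h₁₁ : X₁₁.Correct A₁₁ α l₁₁) :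
    colProj X₂₁.D * (X₂₁.U * X₁₁.U) = colProj X₂₁.D * X₂₁.U := by
  rw [← mul_assoc, h₁₁.mul_U_of_mul_colProj]
  rw [mul_assoc, hc.left.U_mul_proj, hc.left.proj_mul_proj]

theorem Compatible.colProj₁₂_mul_U₂₂ (hc : Compatible X₁₁ X₂₁ X₁₂ X₂₂ C V) (lam : F)
    (h₁₂ : X₁₂.Correct A₁₂ κ l₁₂) (h₂₂ : X₂₂.Correct A₂₂ σ l₂₂) :
    colProj X₁₂.D * (X₂₂.U * (weight lam (colProj X₁₂.D) * X₁₂.U)) =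
      colProj X₁₂.D * (lam • X₁₂.U) := by
  rw [← mul_assoc, h₂₂.mul_U_of_mul_colProj hc.right.proj_mul_proj', ← mul_assoc,
    mul_weight_of_mul_eq_self _ h₁₂.perm.colProj_mul_colProj, smul_mul_assoc, mul_smul_comm]

theorem Compatible.colProj₂₂_mul_U₂₂ (hc : Compatible X₁₁ X₂₁ X₁₂ X₂₂ C V) (lam : F)
    (h₁₂ : X₁₂.Correct A₁₂ κ l₁₂) :
    colProj X₂₂.D * (X₂₂.U * (weight lam (colProj X₁₂.D) * X₁₂.U)) = colProj X₂₂.D * X₂₂.U := by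
  have h0 : colProj X₂₂.D * X₂₂.U * colProj X₁₂.D = 0 := by
    rw [mul_assoc, hc.right.U_mul_proj, hc.right.proj_mul_proj]
  rw [← mul_assoc, ← mul_assoc, mul_weight_of_mul_eq_zero _ h0, h₁₂.mul_U_of_mul_colProj h0]

theorem mem_combine_D_iff (h₁₁ : X₁₁.Correct A₁₁ α l₁₁) (h₂₁ : X₂₁.Correct A₂₁ κ l₂₁)
    (h₁₂ : X₁₂.Correct A₁₂ κ l₁₂) (h₂₂ : X₂₂.Correct A₂₂ σ l₂₂) (hlam : X₂₁.αr / X₁₁.αr ≠ 0) :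
    ∀ i j, (combine α X₁₁ X₂₁ X₁₂ X₂₂ C V).D i j ≠ 0 ↔ (i, j) ∈ joinPivots l₁₁ l₂₁ l₁₂ l₂₂ := by
  have hlam' : ((X₂₁.αr / X₁₁.αr) ^ 2)⁻¹ ≠ 0 := inv_ne_zero (pow_ne_zero _ hlam)
  simp only [forall_halves, combine, joinBlocks_lo_lo, joinBlocks_lo_hi, joinBlocks_hi_lo,
    joinBlocks_hi_hi, joinPivots, List.mem_append, List.mem_map, Prod.exists, Prod.map_apply,
    Prod.mk.injEq, lo_inj, hi_inj, lo_ne_hi, (lo_ne_hi _ _).symm, and_false, false_and,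
    exists_false, false_or, or_false, Matrix.smul_apply, smul_eq_mul, mul_ne_zero_iff,
    hlam', ne_eq, not_false_eq_true, true_and]
  have key : ∀ (l : List (Fin (2 ^ p) × Fin (2 ^ p))) (i j : Fin (2 ^ p)),
      (∃ a b, (a, b) ∈ l ∧ a = i ∧ b = j) ↔ (i, j) ∈ l := by
    intro l i j
    constructor
    · rintro ⟨a, b, h, rfl, rfl⟩
      exact h
    · exact fun h => ⟨i, j, h, rfl, rfl⟩
  simp only [key]
  exact ⟨fun i => ⟨fun j => h₁₁.mem_iff i j, fun j => by simpa [hlam'] using h₁₂.mem_iff i j⟩,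
    fun i => ⟨fun j => h₂₁.mem_iff i j, fun j => h₂₂.mem_iff i j⟩⟩

theorem pairwise_combine (hc : Compatible X₁₁ X₂₁ X₁₂ X₂₂ C V)
    (h₁₁ : X₁₁.Correct A₁₁ α l₁₁) (h₂₁ : X₂₁.Correct A₂₁ κ l₂₁)
    (h₁₂ : X₁₂.Correct A₁₂ κ l₁₂) (h₂₂ : X₂₂.Correct A₂₂ σ l₂₂) :
    (joinPivots l₁₁ l₂₁ l₁₂ l₂₂).Pairwise fun x y =>
      (combine α X₁₁ X₂₁ X₁₂ X₂₂ C V).L x.1 y.1 = 0 ∧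
      (combine α X₁₁ X₂₁ X₁₂ X₂₂ C V).U y.2 x.2 = 0 := by
  have m₁₁ : ∀ {x : Fin (2 ^ p) × Fin (2 ^ p)}, x ∈ l₁₁ → X₁₁.D x.1 x.2 ≠ 0 :=
    fun hx => (h₁₁.mem_iff _ _).mpr hx
  have m₂₁ : ∀ {x : Fin (2 ^ p) × Fin (2 ^ p)}, x ∈ l₂₁ → X₂₁.D x.1 x.2 ≠ 0 :=
    fun hx => (h₂₁.mem_iff _ _).mpr hx
  have m₁₂ : ∀ {x : Fin (2 ^ p) × Fin (2 ^ p)}, x ∈ l₁₂ → X₁₂.D x.1 x.2 ≠ 0 :=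
    fun hx => (h₁₂.mem_iff _ _).mpr hx
  have m₂₂ : ∀ {x : Fin (2 ^ p) × Fin (2 ^ p)}, x ∈ l₂₂ → X₂₂.D x.1 x.2 ≠ 0 :=
    fun hx => (h₂₂.mem_iff _ _).mpr hx
  have z₁ : rowProj X₁₁.D * (X₁₁.L * (X₁₂.L * weight (X₂₁.αr / X₁₁.αr) (rowProj X₁₂.D))) *
      rowProj X₁₂.D = 0 := by
    rw [mul_assoc, hc.L₁₁_mul_rowProj₁₂ _ h₁₁ h₁₂, ← mul_assoc, mul_smul_comm,
      hc.upper.proj_mul_L, smul_mul_assoc, hc.upper.proj_mul_proj, smul_zero]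
  have z₂ : rowProj X₂₁.D * (X₂₁.L * X₂₂.L) * rowProj X₂₂.D = 0 := by
    rw [mul_assoc, hc.L₂₂_mul_rowProj₂₂ h₂₁, ← mul_assoc, hc.lower.proj_mul_L,
      hc.lower.proj_mul_proj]
  have z₃ : colProj X₂₁.D * (X₂₁.U * X₁₁.U) * colProj X₁₁.D = 0 := by
    rw [hc.colProj₂₁_mul_U₁₁ h₁₁, mul_assoc, hc.left.U_mul_proj, hc.left.proj_mul_proj]
  have z₄ : colProj X₂₂.D * (X₂₂.U * (weight (X₂₁.αr / X₁₁.αr) (colProj X₁₂.D) * X₁₂.U)) *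
      colProj X₁₂.D = 0 := by
    rw [hc.colProj₂₂_mul_U₂₂ _ h₁₂, mul_assoc, hc.right.U_mul_proj, hc.right.proj_mul_proj]
  rw [joinPivots]
  simp only [List.pairwise_append, List.pairwise_map, List.forall_mem_append, List.forall_mem_map,
    Prod.map_fst, Prod.map_snd, combine, joinBlocks_lo_lo, joinBlocks_lo_hi, joinBlocks_hi_lo,
    joinBlocks_hi_hi, Matrix.zero_apply, and_true, true_and]
  refine ⟨h₁₁.pairwise.imp_of_mem fun hx hy h => ⟨?_, ?_⟩,
    ⟨h₂₁.pairwise.imp_of_mem fun hx hy h => ⟨?_, ?_⟩,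
      ⟨h₁₂.pairwise.imp_of_mem fun hx hy h => ⟨?_, ?_⟩,
        h₂₂.pairwise.imp_of_mem fun hx hy h => ⟨?_, ?_⟩, fun x hx y hy => ?_⟩,
      fun x hx => ⟨fun y hy => ?_, fun y hy => ?_⟩⟩,
    fun x hx => ⟨fun y hy => ?_, fun y hy => ?_, fun y hy => ?_⟩⟩
  · rw [apply_eq_of_mul_rowProj h₁₁.perm (hc.L₁₁_mul_rowProj₁₁ _ h₁₂) (m₁₁ hy), h.1]
  · rw [apply_eq_of_colProj_mul h₁₁.perm (hc.colProj₁₁_mul_U₁₁ h₂₁) (m₁₁ hy), h.2]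
  · rw [apply_eq_of_mul_rowProj h₂₁.perm (hc.L₂₂_mul_rowProj₂₁ h₂₂) (m₂₁ hy), h.1]
  · rw [apply_eq_of_colProj_mul h₂₁.perm (hc.colProj₂₁_mul_U₁₁ h₁₁) (m₂₁ hy), h.2]
  · rw [apply_eq_of_mul_rowProj h₁₂.perm (hc.L₁₁_mul_rowProj₁₂ _ h₁₁ h₁₂) (m₁₂ hy),
      Matrix.smul_apply, h.1, smul_zero]
  · rw [apply_eq_of_colProj_mul h₁₂.perm (hc.colProj₁₂_mul_U₂₂ _ h₁₂ h₂₂) (m₁₂ hy),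
      Matrix.smul_apply, h.2, smul_zero]
  · rw [apply_eq_of_mul_rowProj h₂₂.perm (hc.L₂₂_mul_rowProj₂₂ h₂₁) (m₂₂ hy), h.1]
  · rw [apply_eq_of_colProj_mul h₂₂.perm (hc.colProj₂₂_mul_U₂₂ _ h₁₂) (m₂₂ hy), h.2]
  · exact apply_eq_zero_of_colProj_mul h₂₂.perm h₁₂.perm z₄ (m₂₂ hy) (m₁₂ hx)
  · exact apply_eq_zero_of_rowProj_mul h₂₁.perm h₁₂.perm hc.mul_C_mul (m₂₁ hx) (m₁₂ hy)
  · exact apply_eq_zero_of_rowProj_mul h₂₁.perm h₂₂.perm z₂ (m₂₁ hx) (m₂₂ hy)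
  · exact apply_eq_zero_of_colProj_mul h₂₁.perm h₁₁.perm z₃ (m₂₁ hy) (m₁₁ hx)
  · exact apply_eq_zero_of_rowProj_mul h₁₁.perm h₁₂.perm z₁ (m₁₁ hx) (m₁₂ hy)
  · trivial

theorem diag_combine (hc : Compatible X₁₁ X₂₁ X₁₂ X₂₂ C V)
    (h₁₁ : X₁₁.Correct A₁₁ α l₁₁) (h₂₁ : X₂₁.Correct A₂₁ κ l₂₁)
    (h₁₂ : X₁₂.Correct A₁₂ κ l₁₂) (h₂₂ : X₂₂.Correct A₂₂ σ l₂₂) :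
    ∀ x ∈ joinPivots l₁₁ l₂₁ l₁₂ l₂₂, (combine α X₁₁ X₂₁ X₁₂ X₂₂ C V).U x.2 x.2 =
      (combine α X₁₁ X₂₁ X₁₂ X₂₂ C V).L x.1 x.1 := by
  rw [joinPivots]
  simp only [List.forall_mem_append, List.forall_mem_map,
    Prod.map_fst, Prod.map_snd, combine, joinBlocks_lo_lo, joinBlocks_hi_hi]
  refine ⟨fun x hx => ?_, fun x hx => ?_, fun x hx => ?_, fun x hx => ?_⟩
  · have hD := (h₁₁.mem_iff _ _).mpr hx
    rw [apply_eq_of_mul_rowProj h₁₁.perm (hc.L₁₁_mul_rowProj₁₁ _ h₁₂) hD,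
      apply_eq_of_colProj_mul h₁₁.perm (hc.colProj₁₁_mul_U₁₁ h₂₁) hD, h₁₁.diag_eq x hx]
  · have hD := (h₂₁.mem_iff _ _).mpr hx
    rw [apply_eq_of_mul_rowProj h₂₁.perm (hc.L₂₂_mul_rowProj₂₁ h₂₂) hD,
      apply_eq_of_colProj_mul h₂₁.perm (hc.colProj₂₁_mul_U₁₁ h₁₁) hD, h₂₁.diag_eq x hx]
  · have hD := (h₁₂.mem_iff _ _).mpr hx
    rw [apply_eq_of_mul_rowProj h₁₂.perm (hc.L₁₁_mul_rowProj₁₂ _ h₁₁ h₁₂) hD,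
      apply_eq_of_colProj_mul h₁₂.perm (hc.colProj₁₂_mul_U₂₂ _ h₁₂ h₂₂) hD,
      Matrix.smul_apply, Matrix.smul_apply, h₁₂.diag_eq x hx]
  · have hD := (h₂₂.mem_iff _ _).mpr hx
    rw [apply_eq_of_mul_rowProj h₂₂.perm (hc.L₂₂_mul_rowProj₂₂ h₂₁) hD,
      apply_eq_of_colProj_mul h₂₂.perm (hc.colProj₂₂_mul_U₂₂ _ h₁₂) hD, h₂₂.diag_eq x hx]

/-- The chains of the four calls follow one another; that of `X₁₂` starts from `α_k` and is
scaled by `λ` so that it starts from `α_l`, where that of `X₂₁` has ended. -/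
theorem chain_combine (hc : Compatible X₁₁ X₂₁ X₁₂ X₂₂ C V) (hα : α ≠ 0)
    (h₁₁ : X₁₁.Correct A₁₁ α l₁₁) (h₂₁ : X₂₁.Correct A₂₁ X₁₁.αr l₂₁)
    (h₁₂ : X₁₂.Correct A₁₂ X₁₁.αr l₁₂)
    (h₂₂ : X₂₂.Correct A₂₂ (X₂₁.αr / X₁₁.αr * X₁₂.αr) l₂₂) :
    PivotChain (combine α X₁₁ X₂₁ X₁₂ X₂₂ C V).D (combine α X₁₁ X₂₁ X₁₂ X₂₂ C V).L α
      (joinPivots l₁₁ l₂₁ l₁₂ l₂₂) X₂₂.αr := by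
  have hκ := h₁₁.chain.ne_zero hα
  have hlam : X₂₁.αr / X₁₁.αr ≠ 0 := div_ne_zero (h₂₁.chain.ne_zero hκ) hκ
  rw [joinPivots]
  refine .append (b := X₁₁.αr) ?_ (.append (b := X₂₁.αr) ?_
    (.append (b := X₂₁.αr / X₁₁.αr * X₁₂.αr) ?_ ?_))
  · rw [← one_mul α, ← one_mul X₁₁.αr]
    refine h₁₁.chain.map lo lo one_ne_zero (fun x hx => ?_) fun x hx => ?_
    · simp only [combine, joinBlocks_lo_lo, one_pow, inv_one, one_mul]
    · have hD := (h₁₁.mem_iff _ _).mpr hx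
      simp only [combine, joinBlocks_lo_lo, one_mul]
      rw [apply_eq_of_mul_rowProj h₁₁.perm (hc.L₁₁_mul_rowProj₁₁ _ h₁₂) hD]
  · have := h₂₁.chain.map (D' := (combine α X₁₁ X₂₁ X₁₂ X₂₂ C V).D)
      (L' := (combine α X₁₁ X₂₁ X₁₂ X₂₂ C V).L) hi lo one_ne_zero (fun x hx => ?_) fun x hx => ?_
    · rwa [one_mul, one_mul] at this
    · simp only [combine, joinBlocks_hi_lo, one_pow, inv_one, one_mul]
    · have hD := (h₂₁.mem_iff _ _).mpr hx
      simp only [combine, joinBlocks_hi_hi, one_mul]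
      rw [apply_eq_of_mul_rowProj h₂₁.perm (hc.L₂₂_mul_rowProj₂₁ h₂₂) hD]
  · have := h₁₂.chain.map (D' := (combine α X₁₁ X₂₁ X₁₂ X₂₂ C V).D)
      (L' := (combine α X₁₁ X₂₁ X₁₂ X₂₂ C V).L) lo hi hlam (fun x hx => ?_) fun x hx => ?_
    · rwa [div_mul_cancel₀ _ hκ] at this
    · simp only [combine, joinBlocks_lo_hi, Matrix.smul_apply, smul_eq_mul]
    · have hD := (h₁₂.mem_iff _ _).mpr hx
      simp only [combine, joinBlocks_lo_lo]
      rw [apply_eq_of_mul_rowProj h₁₂.perm (hc.L₁₁_mul_rowProj₁₂ _ h₁₁ h₁₂) hD,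
        Matrix.smul_apply, smul_eq_mul]
  · have := h₂₂.chain.map (D' := (combine α X₁₁ X₂₁ X₁₂ X₂₂ C V).D)
      (L' := (combine α X₁₁ X₂₁ X₁₂ X₂₂ C V).L) hi hi one_ne_zero (fun x hx => ?_) fun x hx => ?_
    · rwa [one_mul, one_mul] at this
    · simp only [combine, joinBlocks_hi_hi, one_pow, inv_one, one_mul]
    · have hD := (h₂₂.mem_iff _ _).mpr hx
      simp only [combine, joinBlocks_hi_hi, one_mul]
      rw [apply_eq_of_mul_rowProj h₂₂.perm (hc.L₂₂_mul_rowProj₂₂ h₂₁) hD]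

theorem left_norm_combine (hc : Compatible X₁₁ X₂₁ X₁₂ X₂₂ C V)
    (h₁₁ : X₁₁.Correct A₁₁ α l₁₁) (h₂₁ : X₂₁.Correct A₂₁ κ l₂₁)
    (h₁₂ : X₁₂.Correct A₁₂ κ l₁₂) (h₂₂ : X₂₂.Correct A₂₂ σ l₂₂) (hlam : X₂₁.αr / X₁₁.αr ≠ 0)
    (h : IsTruncWeightedPerm (combine α X₁₁ X₂₁ X₁₂ X₂₂ C V).D) :
    (combine α X₁₁ X₂₁ X₁₂ X₂₂ C V).L * (1 - rowProj (combine α X₁₁ X₂₁ X₁₂ X₂₂ C V).D) =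
      1 - rowProj (combine α X₁₁ X₂₁ X₁₂ X₂₂ C V).D := by
  have hn : 1 - rowProj (combine α X₁₁ X₂₁ X₁₂ X₂₂ C V).D = _ := one_sub_rowProj_joinBlocks
    (inv_ne_zero (pow_ne_zero 2 hlam)) h₁₁.perm h₁₂.perm h₂₁.perm h₂₂.perm h
  have hu : rowProj X₁₁.D * ((1 - rowProj X₁₁.D) * (1 - rowProj X₁₂.D)) = 0 :=
    mul_one_sub_mul_one_sub_left h₁₁.perm.rowProj_mul_rowProj
  have hu' : rowProj X₁₂.D * ((1 - rowProj X₁₁.D) * (1 - rowProj X₁₂.D)) = 0 :=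
    mul_one_sub_mul_one_sub_right h₁₂.perm.rowProj_mul_rowProj hc.upper.proj_mul_proj'
  have hl : rowProj X₂₁.D * ((1 - rowProj X₂₁.D) * (1 - rowProj X₂₂.D)) = 0 :=
    mul_one_sub_mul_one_sub_left h₂₁.perm.rowProj_mul_rowProj
  have hl' : rowProj X₂₂.D * ((1 - rowProj X₂₁.D) * (1 - rowProj X₂₂.D)) = 0 :=
    mul_one_sub_mul_one_sub_right h₂₂.perm.rowProj_mul_rowProj hc.lower.proj_mul_proj'
  rw [hn]
  simp only [combine]
  rw [joinBlocks_mul, hc.C_mul, mul_assoc X₁₁.L, mul_assoc X₁₂.L, weight_mul_of_mul_eq_zero _ hu',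
    h₁₂.L_mul_of_rowProj_mul hu', h₁₁.L_mul_of_rowProj_mul hu,
    mul_assoc X₂₁.L X₂₂.L (_ * _),
    h₂₂.L_mul_of_rowProj_mul hl', h₂₁.L_mul_of_rowProj_mul hl]
  simp

theorem right_norm_combine (hc : Compatible X₁₁ X₂₁ X₁₂ X₂₂ C V)
    (h₁₁ : X₁₁.Correct A₁₁ α l₁₁) (h₂₁ : X₂₁.Correct A₂₁ κ l₂₁)
    (h₁₂ : X₁₂.Correct A₁₂ κ l₁₂) (h₂₂ : X₂₂.Correct A₂₂ σ l₂₂) (hlam : X₂₁.αr / X₁₁.αr ≠ 0)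
    (h : IsTruncWeightedPerm (combine α X₁₁ X₂₁ X₁₂ X₂₂ C V).D) :
    (1 - colProj (combine α X₁₁ X₂₁ X₁₂ X₂₂ C V).D) * (combine α X₁₁ X₂₁ X₁₂ X₂₂ C V).U =
      1 - colProj (combine α X₁₁ X₂₁ X₁₂ X₂₂ C V).D := by
  have hn : 1 - colProj (combine α X₁₁ X₂₁ X₁₂ X₂₂ C V).D = _ := one_sub_colProj_joinBlocks
    (inv_ne_zero (pow_ne_zero 2 hlam)) h₁₁.perm h₁₂.perm h₂₁.perm h₂₂.perm h
  have hl : (1 - colProj X₁₁.D) * (1 - colProj X₂₁.D) * colProj X₂₁.D = 0 :=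
    one_sub_mul_one_sub_mul_right h₂₁.perm.colProj_mul_colProj
  have hl' : (1 - colProj X₁₁.D) * (1 - colProj X₂₁.D) * colProj X₁₁.D = 0 :=
    one_sub_mul_one_sub_mul_left h₁₁.perm.colProj_mul_colProj hc.left.proj_mul_proj
  have hr : (1 - colProj X₁₂.D) * (1 - colProj X₂₂.D) * colProj X₂₂.D = 0 :=
    one_sub_mul_one_sub_mul_right h₂₂.perm.colProj_mul_colProj
  have hr' : (1 - colProj X₁₂.D) * (1 - colProj X₂₂.D) * colProj X₁₂.D = 0 :=
    one_sub_mul_one_sub_mul_left h₁₂.perm.colProj_mul_colProj hc.right.proj_mul_proj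
  rw [hn]
  simp only [combine]
  rw [joinBlocks_mul, hc.mul_V, ← mul_assoc _ X₂₁.U, h₂₁.mul_U_of_mul_colProj hl,
    h₁₁.mul_U_of_mul_colProj hl', ← mul_assoc (_ * _) X₂₂.U, h₂₂.mul_U_of_mul_colProj hr,
    ← mul_assoc (_ * _) (weight _ _), mul_weight_of_mul_eq_zero _ hr', h₁₂.mul_U_of_mul_colProj hr']
  simp

theorem left_inv_combine (h₁₁ : X₁₁.Correct A₁₁ α l₁₁) (h₂₁ : X₂₁.Correct A₂₁ κ l₂₁)
    (h₁₂ : X₁₂.Correct A₁₂ κ l₁₂) (h₂₂ : X₂₂.Correct A₂₂ σ l₂₂) (hlam : X₂₁.αr / X₁₁.αr ≠ 0)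
    (h : IsUnit (combine α X₁₁ X₂₁ X₁₂ X₂₂ C V).Dhat) :
    (combine α X₁₁ X₂₁ X₁₂ X₂₂ C V).L * (combine α X₁₁ X₂₁ X₁₂ X₂₂ C V).Dhat *
      (combine α X₁₁ X₂₁ X₁₂ X₂₂ C V).M = 1 := by
  have e2 : ∀ Y, X₁₂.L * (X₁₂.Dhat * (X₁₂.M * Y)) = Y := fun Y => by
    rw [← mul_assoc, ← mul_assoc, h₁₂.left_inv, one_mul]
  have e3 : ∀ Y, X₂₂.L * (X₂₂.Dhat * (X₂₂.M * Y)) = Y := fun Y => by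
    rw [← mul_assoc, ← mul_assoc, h₂₂.left_inv, one_mul]
  have e4 : ∀ Y, X₂₁.L * (X₂₁.Dhat * (X₂₁.M * Y)) = Y := fun Y => by
    rw [← mul_assoc, ← mul_assoc, h₂₁.left_inv, one_mul]
  have ew : ∀ Y, weight (X₂₁.αr / X₁₁.αr) (rowProj X₁₂.D) *
      (weight (X₂₁.αr / X₁₁.αr)⁻¹ (rowProj X₁₂.D) * Y) = Y := fun Y => by
    rw [← mul_assoc, weight_mul_weight_inv hlam h₁₂.perm.rowProj_mul_rowProj, one_mul]
  have e1' := h₁₁.left_inv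
  have e4' := h₂₁.left_inv
  rw [mul_assoc] at e1' e4'
  change _ * _ * ((combine α X₁₁ X₂₁ X₁₂ X₂₂ C V).Dhat⁻¹ * _) = _
  rw [mul_assoc, Matrix.mul_nonsing_inv_cancel_left _ _ ((Matrix.isUnit_iff_isUnit_det _).mp h)]
  simp only [combine]
  rw [joinBlocks_mul, ← joinBlocks_one]
  simp only [mul_assoc, mul_neg, e2, e3, e4, ew, e1', e4', mul_zero, zero_mul, add_zero,
    zero_add, add_neg_cancel, neg_zero]

theorem right_inv_combine (h₁₁ : X₁₁.Correct A₁₁ α l₁₁) (h₂₁ : X₂₁.Correct A₂₁ κ l₂₁)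
    (h₁₂ : X₁₂.Correct A₁₂ κ l₁₂) (h₂₂ : X₂₂.Correct A₂₂ σ l₂₂) (hlam : X₂₁.αr / X₁₁.αr ≠ 0)
    (h : IsUnit (combine α X₁₁ X₂₁ X₁₂ X₂₂ C V).Dhat) :
    (combine α X₁₁ X₂₁ X₁₂ X₂₂ C V).W * (combine α X₁₁ X₂₁ X₁₂ X₂₂ C V).Dhat *
      (combine α X₁₁ X₂₁ X₁₂ X₂₂ C V).U = 1 := by
  have e3 : ∀ Y, X₂₂.W * (X₂₂.Dhat * (X₂₂.U * Y)) = Y := fun Y => by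
    rw [← mul_assoc, ← mul_assoc, h₂₂.right_inv, one_mul]
  have e4 : ∀ Y, X₂₁.W * (X₂₁.Dhat * (X₂₁.U * Y)) = Y := fun Y => by
    rw [← mul_assoc, ← mul_assoc, h₂₁.right_inv, one_mul]
  have ew : ∀ Y, weight (X₂₁.αr / X₁₁.αr)⁻¹ (colProj X₁₂.D) *
      (weight (X₂₁.αr / X₁₁.αr) (colProj X₁₂.D) * Y) = Y := fun Y => by
    have := weight_mul_weight_inv (inv_ne_zero hlam) h₁₂.perm.colProj_mul_colProj
    rw [inv_inv] at this
    rw [← mul_assoc, this, one_mul]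
  have e1' := h₁₁.right_inv
  have e2' := h₁₂.right_inv
  rw [mul_assoc] at e1' e2'
  change _ * (combine α X₁₁ X₂₁ X₁₂ X₂₂ C V).Dhat⁻¹ * _ * _ = _
  rw [Matrix.nonsing_inv_mul_cancel_right _ _ ((Matrix.isUnit_iff_isUnit_det _).mp h)]
  simp only [combine]
  rw [joinBlocks_mul, ← joinBlocks_one]
  simp only [mul_assoc, neg_mul, e3, e4, ew, e1', e2', mul_zero, zero_mul, add_zero,
    zero_add, add_neg_cancel, mul_one]

end Shape

end Combine

/-! ### Correctness of the recursion -/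

section Recursion

variable {F : Type*} [Field F] [DecidableEq F] {p : ℕ} {α : F} {X₁₁ X₂₁ X₁₂ X₂₂ : Output F (2 ^ p)}
  {A₁₁ A₁₂ A₂₁ A₂₂ : Matrix (Fin (2 ^ p)) (Fin (2 ^ p)) F}
  {l₁₁ l₂₁ l₁₂ l₂₂ : List (Fin (2 ^ p) × Fin (2 ^ p))}

/-- The factors `D̄` in the inputs of the later calls kill the pivot rows and columns of the
earlier ones, so the four calls never share a pivot row or a pivot column. -/
theorem compatible_of_correct (hα : α ≠ 0) (h₁₁ : X₁₁.Correct A₁₁ α l₁₁)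
    (h₂₁ : X₂₁.Correct (input₂₁ α X₁₁ A₂₁) X₁₁.αr l₂₁)
    (h₁₂ : X₁₂.Correct (input₁₂ α X₁₁ A₁₂) X₁₁.αr l₁₂)
    (h₂₂ : X₂₂.Correct (input₂₂ α X₁₁ X₂₁ X₁₂ A₁₂ A₂₁ A₂₂) (X₂₁.αr / X₁₁.αr * X₁₂.αr) l₂₂) :
    Compatible X₁₁ X₂₁ X₁₂ X₂₂ (lowerLeft α X₁₁ X₂₁ X₁₂ A₁₂ A₂₁ A₂₂)
      (upperRight α X₁₁ X₂₁ A₁₂ A₂₁ A₂₂) := by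
  have hκ := h₁₁.chain.ne_zero hα
  have hσ : X₂₁.αr / X₁₁.αr * X₁₂.αr ≠ 0 :=
    mul_ne_zero (div_ne_zero (h₂₁.chain.ne_zero hκ) hκ) (h₁₂.chain.ne_zero hκ)
  have hu : RowsDisjoint X₁₁ X₁₂ := .of_mul_eq_zero h₁₁ h₁₂ hκ <| by
    rw [input₁₂, mul_smul_comm, ← mul_assoc, h₁₁.perm.rowProj_mul_compl, zero_mul, smul_zero]
  have hl : ColsDisjoint X₁₁ X₂₁ := .of_mul_eq_zero h₁₁ h₂₁ hκ <| by
    rw [input₂₁, smul_mul_assoc, mul_assoc, h₁₁.perm.compl_mul_colProj, mul_zero, smul_zero]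
  refine ⟨hu, .of_mul_eq_zero h₂₁ h₂₂ hσ ?_, hl, .of_mul_eq_zero h₁₂ h₂₂ hσ ?_, ?_, ?_, ?_⟩
  · rw [input₂₂, mul_smul_comm]
    simp only [mul_assoc, mul_mul_eq_of_mul_eq h₂₁.perm.rowProj_mul_compl, zero_mul, smul_zero]
  · rw [input₂₂, smul_mul_assoc, mul_assoc, h₁₂.perm.compl_mul_colProj, mul_zero, smul_zero]
  · rw [lowerLeft, add_mul, smul_mul_assoc, smul_mul_assoc, mul_assoc _ (rowProj X₁₁.D),
      mul_one_sub_mul_one_sub_left h₁₁.perm.rowProj_mul_rowProj, mul_assoc _ (rowProj X₁₂.D),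
      mul_one_sub_mul_one_sub_right h₁₂.perm.rowProj_mul_rowProj hu.proj_mul_proj']
    simp
  · rw [lowerLeft, mul_add, add_mul]
    simp only [mul_smul_comm, smul_mul_assoc, mul_assoc, hu.proj_mul_proj,
      mul_mul_eq_of_mul_eq h₂₁.perm.rowProj_mul_compl, zero_mul, mul_zero, smul_zero, add_zero]
  · rw [upperRight, mul_add, mul_smul_comm, mul_smul_comm]
    simp only [← mul_assoc]
    rw [one_sub_mul_one_sub_mul_left h₁₁.perm.colProj_mul_colProj hl.proj_mul_proj,
      one_sub_mul_one_sub_mul_right h₂₁.perm.colProj_mul_colProj]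
    simp

theorem factor_combine (hα : α ≠ 0) (h₁₁ : X₁₁.Correct A₁₁ α l₁₁)
    (h₂₁ : X₂₁.Correct (input₂₁ α X₁₁ A₂₁) X₁₁.αr l₂₁)
    (h₁₂ : X₁₂.Correct (input₁₂ α X₁₁ A₁₂) X₁₁.αr l₁₂)
    (h₂₂ : X₂₂.Correct (input₂₂ α X₁₁ X₂₁ X₁₂ A₁₂ A₂₁ A₂₂) (X₂₁.αr / X₁₁.αr * X₁₂.αr) l₂₂) :
    let Z := combine α X₁₁ X₂₁ X₁₂ X₂₂ (lowerLeft α X₁₁ X₂₁ X₁₂ A₁₂ A₂₁ A₂₂)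
      (upperRight α X₁₁ X₂₁ A₁₂ A₂₁ A₂₂)
    α • (Z.L * Z.D * Z.U) = joinBlocks A₁₁ A₁₂ A₂₁ A₂₂ := by
  intro Z
  have hc := compatible_of_correct hα h₁₁ h₂₁ h₁₂ h₂₂
  have hκ := h₁₁.chain.ne_zero hα
  have hμ := h₂₁.chain.ne_zero hκ
  have hν := h₁₂.chain.ne_zero hκ
  have hlam : X₂₁.αr / X₁₁.αr ≠ 0 := div_ne_zero hμ hκ
  have hinv₁₁ := h₁₁.left_inv
  have hinv₁₁' := h₁₁.right_inv
  have hinv₂₁ := h₂₁.left_inv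
  have hinv₁₂' := h₁₂.right_inv
  rw [h₁₁.dhat] at hinv₁₁ hinv₁₁'
  rw [h₂₁.dhat] at hinv₂₁
  rw [h₁₂.dhat] at hinv₁₂'
  have hC₁ : lowerLeft α X₁₁ X₂₁ X₁₂ A₁₂ A₂₁ A₂₂ * X₁₁.D =
      X₁₁.αr⁻¹ • (A₂₁ * X₁₁.W * X₁₁.D) := by
    rw [lowerLeft, add_mul, smul_mul_assoc, smul_mul_assoc, mul_assoc _ (rowProj X₁₁.D),
      h₁₁.perm.rowProj_mul, mul_assoc _ (rowProj X₁₂.D), hc.upper.proj_mul_D']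
    simp
  have hC₃ : lowerLeft α X₁₁ X₂₁ X₁₂ A₁₂ A₂₁ A₂₂ * X₁₂.D = (X₁₂.αr * X₁₁.αr * α)⁻¹ •
      (compl X₂₁.D * X₂₁.M * remainder₂₂ α X₁₁ A₁₂ A₂₁ A₂₂ * X₁₂.W * X₁₂.D) := by
    rw [lowerLeft, add_mul, smul_mul_assoc, smul_mul_assoc, mul_assoc _ (rowProj X₁₁.D),
      hc.upper.proj_mul_D, mul_assoc _ (rowProj X₁₂.D), h₁₂.perm.rowProj_mul]
    simp
  have hV₁ : X₁₁.D * upperRight α X₁₁ X₂₁ A₁₂ A₂₁ A₂₂ =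
      X₁₁.αr⁻¹ • (X₁₁.D * X₁₁.M * A₁₂) := by
    rw [upperRight, mul_add, mul_smul_comm, mul_smul_comm]
    simp only [← mul_assoc, h₁₁.perm.mul_colProj, hc.left.D_mul_proj', zero_mul, smul_zero,
      add_zero]
  have hV₂ : X₂₁.D * upperRight α X₁₁ X₂₁ A₁₂ A₂₁ A₂₂ =
      (X₂₁.αr * α)⁻¹ • (X₂₁.D * X₂₁.M * remainder₂₂ α X₁₁ A₁₂ A₂₁ A₂₂) := by
    rw [upperRight, mul_add, mul_smul_comm, mul_smul_comm]
    simp only [← mul_assoc, h₂₁.perm.mul_colProj, hc.left.D_mul_proj, zero_mul, smul_zero,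
      zero_add]
  have hE : (α * X₁₁.αr) • remainder₂₂ α X₁₁ A₁₂ A₂₁ A₂₂ = (α * X₁₁.αr ^ 2) • A₂₂ -
      α ^ 2 • (A₂₁ * X₁₁.W * X₁₁.D * X₁₁.M * A₁₂) := by
    -- `D̂ D⁺ D̂` is a multiple of `D`, so the subtracted product is the contribution of the pivots
    -- in the upper left block to the lower right block
    have hD := h₁₁.perm.smul_add_smul_compl_mul_pinv_mul (α * X₁₁.αr⁻¹) X₁₁.αr⁻¹
    rw [← h₁₁.dhat] at hD
    rw [remainder₂₂, smul_smul, mul_inv_cancel₀ (mul_ne_zero hα hκ), one_smul, smul_mul_assoc,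
      smul_mul_assoc, mul_smul_comm, smul_smul]
    congr 1
    calc _ = (X₁₁.αr * X₁₁.αr) •
          (A₂₁ * X₁₁.W * (X₁₁.Dhat * pinv X₁₁.D * X₁₁.Dhat) * X₁₁.M * A₁₂) := by
          simp only [mul_assoc]
      _ = _ := by
          rw [hD, mul_smul_comm, smul_mul_assoc, smul_mul_assoc, smul_smul]
          congr 1
          field_simp
  have hw₁ := weight_mul_of_mul_eq_zero (X₂₁.αr / X₁₁.αr) hc.upper.proj_mul_D'
  have hw₂ := weight_mul_of_mul_eq_self (X₂₁.αr / X₁₁.αr) h₁₂.perm.rowProj_mul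
  have hv₂ := mul_weight_of_mul_eq_self (X₂₁.αr / X₁₁.αr) h₁₂.perm.mul_colProj
  have hv₄ : X₂₂.D * (X₂₂.U * weight (X₂₁.αr / X₁₁.αr) (colProj X₁₂.D)) = X₂₂.D * X₂₂.U := by
    rw [← mul_assoc, mul_weight_of_mul_eq_zero]
    rw [mul_assoc, hc.right.U_mul_proj, hc.right.D_mul_proj]
  have hL₂ : X₂₁.L * compl X₂₁.D = compl X₂₁.D :=
    h₂₁.L_mul_of_rowProj_mul h₂₁.perm.rowProj_mul_compl
  simp only [Z, combine]
  rw [joinBlocks_mul, joinBlocks_mul, smul_joinBlocks]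
  simp only [zero_mul, mul_zero, add_zero]
  congr 1
  · rw [mul_assoc X₁₁.L, mul_assoc X₁₂.L, hw₁, hc.upper.L_mul_D, mul_assoc X₁₁.L, ← mul_assoc X₁₁.D,
      hc.left.D_mul_U, ← mul_assoc X₁₁.L, h₁₁.factor]
  · exact smul_blocks_eq_A₁₂ hα hκ hlam hinv₁₁ h₁₂.factor hw₁ hc.upper.L_mul_D hV₁ hw₂
      hc.right.D_mul_U hv₂
  · exact smul_blocks_eq_A₂₁ hα hκ hinv₁₁' h₂₁.factor hC₁ hc.left.D_mul_U hc.lower.L_mul_D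
  · exact smul_blocks_eq_A₂₂ hα hκ hμ hν hE hinv₂₁ hinv₁₂' h₂₂.factor hC₁ hC₃ hV₁ hV₂
      hc.lower.L_mul_D hc.right.D_mul_U hv₂ hv₄ hL₂

/-- One step of the recursion. -/
theorem combine_correct (hα : α ≠ 0) (h₁₁ : X₁₁.Correct A₁₁ α l₁₁)
    (h₂₁ : X₂₁.Correct (input₂₁ α X₁₁ A₂₁) X₁₁.αr l₂₁)
    (h₁₂ : X₁₂.Correct (input₁₂ α X₁₁ A₁₂) X₁₁.αr l₁₂)
    (h₂₂ : X₂₂.Correct (input₂₂ α X₁₁ X₂₁ X₁₂ A₁₂ A₂₁ A₂₂) (X₂₁.αr / X₁₁.αr * X₁₂.αr) l₂₂) :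
    (combine α X₁₁ X₂₁ X₁₂ X₂₂ (lowerLeft α X₁₁ X₂₁ X₁₂ A₁₂ A₂₁ A₂₂)
      (upperRight α X₁₁ X₂₁ A₁₂ A₂₁ A₂₂)).Correct (joinBlocks A₁₁ A₁₂ A₂₁ A₂₂) α
      (joinPivots l₁₁ l₂₁ l₁₂ l₂₂) := by
  have hc := compatible_of_correct hα h₁₁ h₂₁ h₁₂ h₂₂
  have hκ := h₁₁.chain.ne_zero hα
  have hlam : X₂₁.αr / X₁₁.αr ≠ 0 := div_ne_zero (h₂₁.chain.ne_zero hκ) hκ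
  have hσ := mul_ne_zero hlam (h₁₂.chain.ne_zero hκ)
  have hr := h₂₂.chain.ne_zero hσ
  have hchain := chain_combine hc hα h₁₁ h₂₁ h₁₂ h₂₂
  have hpair := pairwise_combine hc h₁₁ h₂₁ h₁₂ h₂₂
  have hdiag := diag_combine hc h₁₁ h₂₁ h₁₂ h₂₂
  have hmem := mem_combine_D_iff (C := lowerLeft α X₁₁ X₂₁ X₁₂ A₁₂ A₂₁ A₂₂)
    (V := upperRight α X₁₁ X₂₁ A₁₂ A₂₁ A₂₂) h₁₁ h₂₁ h₁₂ h₂₂ hlam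
  have hperm := isTruncWeightedPerm_of_pairwise hpair (fun _ => hchain.diag_ne_zero)
    (fun x hx => hdiag x hx ▸ hchain.diag_ne_zero hx) hmem
  have hunit := hperm.isUnit_smul_add_smul_compl (mul_ne_zero hα (inv_ne_zero hr))
    (inv_ne_zero hr)
  exact
    { lower := isLowerTriangular_combine h₁₁ h₂₁ h₁₂ h₂₂
      upper := isUpperTriangular_combine h₁₁ h₂₁ h₁₂ h₂₂
      factor := factor_combine hα h₁₁ h₂₁ h₁₂ h₂₂
      left_inv := left_inv_combine h₁₁ h₂₁ h₁₂ h₂₂ hlam hunit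
      right_inv := right_inv_combine h₁₁ h₂₁ h₁₂ h₂₂ hlam hunit
      dhat := rfl
      left_norm := left_norm_combine hc h₁₁ h₂₁ h₁₂ h₂₂ hlam hperm
      right_norm := right_norm_combine hc h₁₁ h₂₁ h₁₂ h₂₂ hlam hperm
      pairwise := hpair
      mem_iff := hmem
      diag_eq := hdiag
      chain := hchain }

theorem exists_ldu_correct (p : ℕ) (A : Matrix (Fin (2 ^ p)) (Fin (2 ^ p)) F) {α : F}
    (hα : α ≠ 0) : ∃ l, (ldu p A α).Correct A α l := by
  induction p generalizing α with
  | zero =>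
    by_cases hA : A = 0
    · subst hA
      rw [ldu, if_pos rfl]
      exact ⟨_, zeroOutput_correct _ hα⟩
    · exact ⟨_, ldu_zero_correct hα hA⟩
  | succ p ih =>
    by_cases hA : A = 0
    · subst hA
      rw [ldu, if_pos rfl]
      exact ⟨_, zeroOutput_correct _ hα⟩
    · set B := Matrix.reindex (halves p).symm (halves p).symm A with hB
      obtain ⟨l₁₁, h₁₁⟩ := ih B.toBlocks₁₁ hα
      have hκ := h₁₁.chain.ne_zero hα
      obtain ⟨l₂₁, h₂₁⟩ := ih (input₂₁ α (ldu p B.toBlocks₁₁ α) B.toBlocks₂₁) hκ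
      obtain ⟨l₁₂, h₁₂⟩ := ih (input₁₂ α (ldu p B.toBlocks₁₁ α) B.toBlocks₁₂) hκ
      obtain ⟨l₂₂, h₂₂⟩ := ih (input₂₂ α (ldu p B.toBlocks₁₁ α)
        (ldu p (input₂₁ α (ldu p B.toBlocks₁₁ α) B.toBlocks₂₁) (ldu p B.toBlocks₁₁ α).αr)
        (ldu p (input₁₂ α (ldu p B.toBlocks₁₁ α) B.toBlocks₁₂) (ldu p B.toBlocks₁₁ α).αr)
        B.toBlocks₁₂ B.toBlocks₂₁ B.toBlocks₂₂)
        (mul_ne_zero (div_ne_zero (h₂₁.chain.ne_zero hκ) hκ) (h₁₂.chain.ne_zero hκ))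
      have := combine_correct hα h₁₁ h₂₁ h₁₂ h₂₂
      rw [hB, joinBlocks_toBlocks] at this
      rw [ldu, if_neg hA]
      exact ⟨_, this⟩

end Recursion

/-! ### Bordered minors and the Schur complement -/

section Schur

variable {F : Type*} [Field F] {N k : ℕ}

/-- Bordered minors are minors of the Schur complement of the corner block. -/
theorem borderedMinor_eq_det_schur (𝓜 : Matrix (Fin N) (Fin N) F) (hk : k ≤ N)
    (h : cornerMinor 𝓜 hk ≠ 0) :
    ∃ S : Matrix (Fin N) (Fin N) F, ∀ (m : ℕ) (s t : Fin m → Fin N),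
      borderedMinor 𝓜 hk s t = cornerMinor 𝓜 hk * (S.submatrix s t).det := by
  set C := 𝓜.submatrix (Fin.castLE hk) (Fin.castLE hk) with hC
  let : Invertible C := Matrix.invertibleOfIsUnitDet C (isUnit_iff_ne_zero.mpr h)
  refine ⟨𝓜 - 𝓜.submatrix id (Fin.castLE hk) * ⅟C * 𝓜.submatrix (Fin.castLE hk) id,
    fun m s t => ?_⟩
  have hblocks : 𝓜.submatrix (Sum.elim (Fin.castLE hk) s) (Sum.elim (Fin.castLE hk) t) =
      Matrix.fromBlocks C (𝓜.submatrix (Fin.castLE hk) t) (𝓜.submatrix s (Fin.castLE hk))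
        (𝓜.submatrix s t) := by
    ext (i | i) (j | j) <;> rfl
  rw [borderedMinor, hblocks, Matrix.det_fromBlocks₁₁]
  rfl

end Schur

/-! ### Integrality -/

section Integrality

variable {R F : Type*} [CommRing R] [Field F] [Algebra R F] {n r : ℕ}

theorem map_borderedMinor {N k m : ℕ} (𝓜 : Matrix (Fin N) (Fin N) R) (hk : k ≤ N)
    (s t : Fin m → Fin N) : algebraMap R F (borderedMinor 𝓜 hk s t) =
      borderedMinor (𝓜.map (algebraMap R F)) hk s t := by
  rw [borderedMinor, RingHom.map_det]
  rfl

theorem map_cornerMinor {N k : ℕ} (𝓜 : Matrix (Fin N) (Fin N) R) (hk : k ≤ N) :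
    algebraMap R F (cornerMinor 𝓜 hk) = cornerMinor (𝓜.map (algebraMap R F)) hk := by
  rw [cornerMinor, RingHom.map_det]
  rfl

/-- Sylvester's identity: up to the factor `α`, the minors of `α⁻¹ A`, where `A` is a matrix of
minors surrounding `α`, are bordered minors. -/
theorem IsSurroundingMinors.map_borderedMinor_comp {N k m : ℕ} {𝓜 : Matrix (Fin N) (Fin N) R}
    {hk : k ≤ N} {ρ γ : Fin n → Fin N} {A : Matrix (Fin n) (Fin n) R}
    (hA : IsSurroundingMinors 𝓜 hk ρ γ A) {a : F} (ha : a = algebraMap R F (cornerMinor 𝓜 hk))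
    (ha0 : a ≠ 0) (s t : Fin m → Fin n) :
    algebraMap R F (borderedMinor 𝓜 hk (ρ ∘ s) (γ ∘ t)) =
      a * ((a⁻¹ • A.map (algebraMap R F)).submatrix s t).det := by
  rw [map_cornerMinor] at ha
  obtain ⟨S, hS⟩ := borderedMinor_eq_det_schur (𝓜.map (algebraMap R F)) hk (ha ▸ ha0)
  have hG : a⁻¹ • A.map (algebraMap R F) = S.submatrix ρ γ := by
    ext i j
    rw [Matrix.smul_apply, Matrix.map_apply, hA i j, map_borderedMinor, hS, ← ha,
      Matrix.det_fin_one, smul_eq_mul, inv_mul_cancel_left₀ ha0]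
    rfl
  rw [map_borderedMinor, hS, ← ha, hG]
  rfl

theorem isOver_of_forall_mem {X : Matrix (Fin n) (Fin n) F}
    (h : ∀ i j, X i j ∈ (algebraMap R F).range) : IsOver R X := by
  choose f hf using h
  exact ⟨Matrix.of f, by ext i j; exact (hf i j).symm⟩

theorem IsOver.of_transpose {X : Matrix (Fin n) (Fin n) F} (h : IsOver R X.transpose) :
    IsOver R X := by
  obtain ⟨Y, hY⟩ := h
  exact ⟨Y.transpose, by rw [← Matrix.transpose_transpose X, hY]; rfl⟩

variable {G L U : Matrix (Fin n) (Fin n) F} {s t : Fin r → Fin n} {δ : ℕ → F}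

theorem IsElimination.isOver_left (h : IsElimination G s t δ L U)
    (hG : ∀ (m : ℕ) (u v : Fin m → Fin n), δ 0 * (G.submatrix u v).det ∈ (algebraMap R F).range)
    (hL : ∀ j, j ∉ Set.range s → ∀ i, L i j = (1 : Matrix (Fin n) (Fin n) F) i j) :
    IsOver R L := by
  refine isOver_of_forall_mem fun i j => ?_
  by_cases hj : j ∈ Set.range s
  · obtain ⟨q, rfl⟩ := hj
    have := h.det_bordered q.isLt
      (Fin.snoc (α := fun _ => Fin n) (fun c : Fin q => s (Fin.castLE q.isLt.le c)) i) (by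
        intro c hc
        obtain ⟨c, rfl⟩ : ∃ d : Fin q, c = d.castSucc := ⟨⟨c, by omega⟩, rfl⟩
        rw [Fin.snoc_castSucc]
        rfl)
    rw [Fin.snoc_last] at this
    have hq : Fin.castLE q.isLt (Fin.last (q : ℕ)) = q := rfl
    rw [hq] at this
    rw [← this]
    exact hG _ _ _
  · rw [hL j hj, Matrix.one_apply]
    split_ifs
    · exact one_mem _
    · exact zero_mem _

/-- A right inverse `M` of `L D̂` becomes integral after multiplication with `δ 0`. The row of `M`
that belongs to a pivot is a multiple of a pivot row of `L⁻¹`, every other row is a multiple of a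
row of `L⁻¹` that belongs to no pivot. -/
theorem IsElimination.isOver_smul_inv [DecidableEq F] (h : IsElimination G s t δ L U)
    (hG : ∀ (m : ℕ) (u v : Fin m → Fin n), δ 0 * (G.submatrix u v).det ∈ (algebraMap R F).range)
    (hL : ∀ j, j ∉ Set.range s → ∀ i, L i j = (1 : Matrix (Fin n) (Fin n) F) i j)
    {D M : Matrix (Fin n) (Fin n) F} (hperm : IsTruncWeightedPerm D)
    (hmem : ∀ i j, D i j ≠ 0 ↔ ∃ q, s q = i ∧ t q = j)
    (hD : ∀ q, D (s q) (t q) = (δ q * δ (q + 1))⁻¹)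
    (hM : L * ((δ 0 * (δ r)⁻¹) • D + (δ r)⁻¹ • compl D) * M = 1) : IsOver R (δ 0 • M) := by
  have hδ : ∀ m ≤ r, δ m ∈ (algebraMap R F).range := fun m hm => by
    rw [← h.det_pivots hm]
    exact hG _ _ _
  have hne := h.ne_zero
  set Y := ((δ 0 * (δ r)⁻¹) • D + (δ r)⁻¹ • compl D) * M with hYdef
  have hY : Y * L = 1 := by
    rw [mul_assoc] at hM
    exact mul_eq_one_comm.mp hM
  have hYapply : ∀ i j, Y i j =
      δ 0 * (δ r)⁻¹ * ∑ k, D i k * M k j + (δ r)⁻¹ * ∑ k, compl D i k * M k j := fun i j => by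
    rw [hYdef, add_mul, smul_mul_assoc, smul_mul_assoc, Matrix.add_apply, Matrix.smul_apply,
      Matrix.smul_apply, Matrix.mul_apply, Matrix.mul_apply, smul_eq_mul, smul_eq_mul]
  refine isOver_of_forall_mem fun i j => ?_
  rw [Matrix.smul_apply, smul_eq_mul]
  by_cases hi : i ∈ Set.range t
  · obtain ⟨q, rfl⟩ := hi
    have hDq : D (s q) (t q) ≠ 0 := (hmem _ _).mpr ⟨q, rfl, rfl⟩
    have hrow : s q ∉ zeroRows D := fun hz => hDq (mem_zeroRows.mp hz _)
    have hYq := hYapply (s q) j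
    rw [Finset.sum_eq_single (t q), Finset.sum_eq_zero (f := fun k => compl D (s q) k * M k j),
      mul_zero, add_zero, hD] at hYq
    · have hkey : δ 0 * M (t q) j = δ r * (δ q * δ (q + 1) * Y (s q) j) := by
        have h1 := hne _ q.isLt.le
        have h2 := hne _ q.isLt
        have h3 := hne r le_rfl
        rw [hYq]
        field_simp
      rw [hkey]
      refine mul_mem (hδ r le_rfl) ?_
      rcases h.inv_apply_of_mem hL hY q j with ⟨c, hc⟩ | h0
      · rw [hc, Matrix.adjugate_fin_succ_eq_det_submatrix, mul_left_comm,
          Matrix.submatrix_submatrix]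
        exact mul_mem (pow_mem (neg_mem (one_mem _)) _) (hG _ _ _)
      · rw [h0, mul_zero]
        exact zero_mem _
    · intro k _
      rw [compl_eq_zero_of_row hrow, zero_mul]
    · intro k _ hk
      have : D (s q) k = 0 := by
        by_contra hne'
        exact hk (hperm.row_unique hne' hDq)
      rw [this, zero_mul]
    · simp
  · have hcol : i ∈ zeroCols D := mem_zeroCols.mpr fun k => by
      by_contra hk
      obtain ⟨q, _, hq⟩ := (hmem _ _).mp hk
      exact hi ⟨q, hq⟩
    obtain ⟨k, hk, hki⟩ := hperm.exists_compl_row_of_col hcol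
    have hks : k ∉ Set.range s := by
      rintro ⟨q, rfl⟩
      exact (hmem _ _).mpr ⟨q, rfl, rfl⟩ (mem_zeroRows.mp hk _)
    have hYk := hYapply k j
    simp only [mem_zeroRows.mp hk, hki, zero_mul, Finset.sum_const_zero, mul_zero, zero_add,
      ite_mul, one_mul, Finset.sum_ite_eq', Finset.mem_univ, if_true] at hYk
    have hkey : δ 0 * M i j = δ 0 * (δ r * Y k j) := by
      rw [hYk, mul_inv_cancel_left₀ (hne r le_rfl)]
    rw [hkey]
    refine mul_mem (hδ 0 (Nat.zero_le _)) ?_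
    by_cases hj : j ∈ Set.range s
    · obtain ⟨c, rfl⟩ := hj
      rw [h.inv_apply_of_notMem hL hY hks c]
      exact neg_mem (hG _ _ _)
    · have : Y k j = (1 : Matrix (Fin n) (Fin n) F) k j := by
        rw [← hY, Matrix.mul_apply]
        simp [hL j hj, Matrix.one_apply]
      rw [this, Matrix.one_apply]
      refine mul_mem (hδ r le_rfl) ?_
      split_ifs
      · exact one_mem _
      · exact zero_mem _

end Integrality

/-! ### From the recursive invariant to an elimination -/

section Conclusion

variable {F : Type*} [Field F] [DecidableEq F] {n r : ℕ}

theorem compl_smul {c : F} (hc : c ≠ 0) (D : Matrix (Fin n) (Fin n) F) :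
    compl (c • D) = compl D := by
  have hr : zeroRows (c • D) = zeroRows D := by ext; simp [mem_zeroRows, hc]
  have hcol : zeroCols (c • D) = zeroCols D := by ext; simp [mem_zeroCols, hc]
  simp only [compl, hr, hcol]

theorem rank_eq_card_pivots {D : Matrix (Fin n) (Fin n) F} (h : IsTruncWeightedPerm D)
    {s t : Fin r → Fin n} (hs : Function.Injective s)
    (hmem : ∀ i j, D i j ≠ 0 ↔ ∃ q, s q = i ∧ t q = j) : D.rank = r := by
  have h1 : D.rank = (rowProj D).rank := by
    apply le_antisymm
    · conv_lhs => rw [← h.rowProj_mul]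
      exact Matrix.rank_mul_le_left _ _
    · rw [← h.mul_pinv]
      exact Matrix.rank_mul_le_left _ _
  rw [h1, h.rowProj_eq, Matrix.rank_diagonal]
  have h2 : ∀ i, (if i ∈ zeroRows D then (0 : F) else 1) ≠ 0 ↔ i ∈ Set.range s := by
    intro i
    have : i ∉ zeroRows D ↔ i ∈ Set.range s := by
      rw [mem_zeroRows, not_forall]
      constructor
      · rintro ⟨j, hj⟩
        obtain ⟨q, hq, _⟩ := (hmem _ _).mp hj
        exact ⟨q, hq⟩
      · rintro ⟨q, rfl⟩
        exact ⟨t q, (hmem _ _).mpr ⟨q, rfl, rfl⟩⟩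
    rw [← this]
    simp
  rw [Fintype.card_congr ((Equiv.subtypeEquivRight h2).trans (Equiv.ofInjective s hs).symm),
    Fintype.card_fin]

/-- A product `L D U` is the sum over the nonzero entries of `D` of the products of the columns
of `L` with the rows of `U`. -/
theorem mul_mul_apply_eq_sum_pivots {D : Matrix (Fin n) (Fin n) F} {s t : Fin r → Fin n}
    (hs : Function.Injective s) (hmem : ∀ i j, D i j ≠ 0 ↔ ∃ q, s q = i ∧ t q = j)
    (L U : Matrix (Fin n) (Fin n) F) (i j : Fin n) :
    (L * D * U) i j = ∑ q, L i (s q) * D (s q) (t q) * U (t q) j := by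
  simp only [Matrix.mul_apply, Finset.sum_mul]
  rw [Finset.sum_comm, ← Finset.sum_product', Finset.univ_product_univ]
  refine (Finset.sum_of_injOn (fun q => (s q, t q)) (fun q _ q' _ hq => ?_) (fun _ _ => by simp)
    ?_ fun q _ => rfl).symm
  · exact hs (Prod.ext_iff.mp hq).1
  · rintro ⟨x, y⟩ _ hxy
    have : D x y = 0 := by
      by_contra hne
      obtain ⟨q, rfl, rfl⟩ := (hmem _ _).mp hne
      exact hxy ⟨q, by simp, rfl⟩
    simp [this]

namespace Output.Correct

variable {X : Output F n} {A : Matrix (Fin n) (Fin n) F} {α : F} {l : List (Fin n × Fin n)}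

theorem mem_iff_exists (h : X.Correct A α l) (i j : Fin n) :
    X.D i j ≠ 0 ↔ ∃ q, (l.get q).1 = i ∧ (l.get q).2 = j := by
  rw [h.mem_iff, List.mem_iff_get]
  simp only [Prod.ext_iff]

theorem injective (h : X.Correct A α l) :
    (Function.Injective fun q => (l.get q).1) ∧ Function.Injective fun q => (l.get q).2 :=
  injective_of_pairwise h.pairwise (fun _ => h.chain.diag_ne_zero)
    (fun x hx => h.diag_eq x hx ▸ h.chain.diag_ne_zero hx)

theorem rank_D (h : X.Correct A α l) : X.D.rank = l.length :=
  rank_eq_card_pivots h.perm h.injective.1 h.mem_iff_exists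

theorem rank_D_eq (h : X.Correct A α l) (hα : α ≠ 0) : X.D.rank = A.rank := by
  rw [← h.factor, Matrix.rank_smul_of_mem_nonZeroDivisors _ (mem_nonZeroDivisors_of_ne_zero hα),
    mul_assoc,
    Matrix.rank_mul_eq_right_of_isUnit_det _ _ ((Matrix.isUnit_iff_isUnit_det _).mp h.isUnit_L),
    Matrix.rank_mul_eq_left_of_isUnit_det _ _ ((Matrix.isUnit_iff_isUnit_det _).mp h.isUnit_U)]

theorem L_apply_of_notMem (h : X.Correct A α l) {j : Fin n}
    (hj : j ∉ Set.range fun q => (l.get q).1) (i : Fin n) :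
    X.L i j = (1 : Matrix (Fin n) (Fin n) F) i j := by
  have hz : j ∈ zeroRows X.D := mem_zeroRows.mpr fun k => by
    by_contra hk
    obtain ⟨q, hq, _⟩ := (h.mem_iff_exists _ _).mp hk
    exact hj ⟨q, hq⟩
  have := congrFun (congrFun h.left_norm i) j
  rw [h.perm.one_sub_rowProj, Matrix.mul_diagonal, if_pos hz, mul_one] at this
  rw [this, Matrix.diagonal_apply, Matrix.one_apply]
  split_ifs with hij hzi
  · rfl
  · exact absurd (hij ▸ hz) hzi
  · rfl

theorem U_apply_of_notMem (h : X.Correct A α l) {i : Fin n}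
    (hi : i ∉ Set.range fun q => (l.get q).2) (j : Fin n) :
    X.U i j = (1 : Matrix (Fin n) (Fin n) F) i j := by
  have hz : i ∈ zeroCols X.D := mem_zeroCols.mpr fun k => by
    by_contra hk
    obtain ⟨q, _, hq⟩ := (h.mem_iff_exists _ _).mp hk
    exact hi ⟨q, hq⟩
  have := congrFun (congrFun h.right_norm i) j
  rw [h.perm.one_sub_colProj, Matrix.diagonal_mul, if_pos hz, one_mul] at this
  rw [this, Matrix.diagonal_apply, Matrix.one_apply, if_pos hz]

theorem isElimination (h : X.Correct A α l) (hα : α ≠ 0) {δ : ℕ → F}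
    (hne : ∀ q ≤ l.length, δ q ≠ 0)
    (hδ : ∀ q : Fin l.length, X.L (l.get q).1 (l.get q).1 = δ (q + 1) ∧
      X.D (l.get q).1 (l.get q).2 = (δ q * δ (q + 1))⁻¹) :
    IsElimination (α⁻¹ • A) (fun q => (l.get q).1) (fun q => (l.get q).2) δ X.L X.U where
  ne_zero := hne
  apply_eq i j := by
    rw [← h.factor, smul_smul, inv_mul_cancel₀ hα, one_smul,
      mul_mul_apply_eq_sum_pivots h.injective.1 h.mem_iff_exists]
    simp only [fun q => (hδ q).2]
  left_zero q q' hq := (List.pairwise_iff_get.mp h.pairwise q q' hq).1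
  right_zero q q' hq := (List.pairwise_iff_get.mp h.pairwise q q' hq).2
  left_diag q := (hδ q).1
  right_diag q := by rw [h.diag_eq _ (List.get_mem l q), (hδ q).1]

end Output.Correct

end Conclusion

end LDU

theorem mainTheorem1 {R F : Type*} [CommRing R] [IsDomain R] [Field F] [DecidableEq F]
    [Algebra R F] [IsFractionRing R F] {N k p r : ℕ}
    (𝓜 : Matrix (Fin N) (Fin N) R) (hk : k ≤ N)
    (α : R) (hα : α = LDU.cornerMinor 𝓜 hk) (hα0 : α ≠ 0)
    (ρ γ : Fin (2 ^ p) → Fin N) (A : Matrix (Fin (2 ^ p)) (Fin (2 ^ p)) R)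
    (hA : LDU.IsSurroundingMinors 𝓜 hk ρ γ A)
    (hr : (A.map (algebraMap R F)).rank = r)
    (a : F) (ha : a = algebraMap R F α)
    (X : LDU.Output F (2 ^ p)) (hX : X = LDU.ldu p (A.map (algebraMap R F)) a) :
    -- `L` and `U` are matrices over `R`, and so are `α M` and `α W`
    (LDU.IsOver R X.L ∧ LDU.IsOver R X.U ∧ LDU.IsOver R (a • X.M) ∧ LDU.IsOver R (a • X.W)) ∧
    -- `L` is lower triangular and `U` is upper triangular
    ((∀ i j, i < j → X.L i j = 0) ∧ (∀ i j, j < i → X.U i j = 0)) ∧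
    -- `L`, `U`, `M`, `W` have full rank
    (X.L.rank = 2 ^ p ∧ X.U.rank = 2 ^ p ∧ X.M.rank = 2 ^ p ∧ X.W.rank = 2 ^ p) ∧
    -- `D` is a truncated weighted permutation matrix of rank `r`
    (LDU.IsTruncWeightedPerm X.D ∧ X.D.rank = r) ∧
    -- the nonzero entries of `D` come from a sequence of nested nonzero minors
    (∃ s t : Fin r → Fin (2 ^ p), Function.Injective s ∧ Function.Injective t ∧
      (∀ i j, X.D i j ≠ 0 ↔ ∃ q, s q = i ∧ t q = j) ∧
      ∃ δ : Fin (r + 1) → R,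
        (∀ q, δ q = LDU.nestedMinor 𝓜 hk (ρ ∘ s) (γ ∘ t) q) ∧
        (∀ q, δ q ≠ 0) ∧
        δ 0 = α ∧
        (∀ q : Fin r, X.D (s q) (t q) =
          (algebraMap R F (δ q.castSucc) * algebraMap R F (δ q.succ))⁻¹) ∧
        X.αr = algebraMap R F (δ (Fin.last r))) ∧
    -- the matrix `D̂`
    X.Dhat = X.αr⁻¹ • LDU.ext (a • X.D) ∧
    -- the three factorizations
    (a • (X.L * X.D * X.U) = A.map (algebraMap R F) ∧
      X.L * X.Dhat * X.M = 1 ∧ X.W * X.Dhat * X.U = 1) ∧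
    -- the normalization of `L` and `U`
    (X.L * (1 - LDU.rowProj X.D) = 1 - LDU.rowProj X.D ∧
      (1 - LDU.colProj X.D) * X.U = 1 - LDU.colProj X.D) := by
  have hinj := IsFractionRing.injective R F
  have ha0 : a ≠ 0 := by
    rw [ha]
    exact (map_ne_zero_iff _ hinj).mpr hα0
  obtain ⟨l, h⟩ := LDU.exists_ldu_correct p (A.map (algebraMap R F)) ha0
  rw [← hX] at h
  obtain rfl : l.length = r := by rw [← h.rank_D, h.rank_D_eq ha0, hr]
  obtain ⟨δ, hδ0, hδr, hne, hδ⟩ := h.chain.exists_seq ha0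
  have helim := h.isElimination ha0 hne hδ
  have hminor : ∀ (m : ℕ) (u v : Fin m → Fin (2 ^ p)),
      algebraMap R F (LDU.borderedMinor 𝓜 hk (ρ ∘ u) (γ ∘ v)) =
        δ 0 * ((a⁻¹ • A.map (algebraMap R F)).submatrix u v).det := fun m u v => by
    rw [hδ0]
    exact hA.map_borderedMinor_comp (hα ▸ ha) ha0 u v
  have hG : ∀ (m : ℕ) (u v : Fin m → Fin (2 ^ p)),
      δ 0 * ((a⁻¹ • A.map (algebraMap R F)).submatrix u v).det ∈ (algebraMap R F).range :=
    fun m u v => ⟨_, hminor m u v⟩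
  have hG' : ∀ (m : ℕ) (u v : Fin m → Fin (2 ^ p)),
      δ 0 * ((a⁻¹ • A.map (algebraMap R F)).transpose.submatrix u v).det ∈
        (algebraMap R F).range := fun m u v => by
    rw [← Matrix.transpose_submatrix, Matrix.det_transpose]
    exact hG m v u
  have hL := fun j (hj : j ∉ Set.range fun q => (l.get q).1) => h.L_apply_of_notMem hj
  have hU : ∀ j, j ∉ Set.range (fun q => (l.get q).2) → ∀ i, X.U.transpose i j =
      (1 : Matrix (Fin (2 ^ p)) (Fin (2 ^ p)) F) i j := fun j hj i => by
    rw [Matrix.transpose_apply, h.U_apply_of_notMem hj, Matrix.one_apply, Matrix.one_apply]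
    simp only [eq_comm]
  have hdhat := h.dhat
  rw [← hδr, ← hδ0] at hdhat
  have hrank : ∀ Y : Matrix (Fin (2 ^ p)) (Fin (2 ^ p)) F, IsUnit Y → Y.rank = 2 ^ p :=
    fun Y hY => by rw [Matrix.rank_of_isUnit _ hY, Fintype.card_fin]
  have hnested : ∀ q : Fin (l.length + 1), algebraMap R F (LDU.nestedMinor 𝓜 hk
      (ρ ∘ fun q => (l.get q).1) (γ ∘ fun q => (l.get q).2) q) = δ q := fun q =>
    (hminor q _ _).trans (helim.det_pivots (Nat.lt_succ_iff.mp q.isLt))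
  refine ⟨⟨helim.isOver_left hG hL, ?_, ?_, ?_⟩, ⟨fun i j hij => h.lower hij,
    fun i j hij => h.upper hij⟩, ⟨hrank _ h.isUnit_L, hrank _ h.isUnit_U, hrank _ h.isUnit_M,
    hrank _ h.isUnit_W⟩, ⟨h.perm, h.rank_D⟩, ⟨_, _, h.injective.1, h.injective.2,
    h.mem_iff_exists, _, fun q => rfl, fun q => ?_, ?_, fun q => ?_, ?_⟩, ?_,
    ⟨h.factor, h.left_inv, h.right_inv⟩, h.left_norm, h.right_norm⟩
  · exact .of_transpose (helim.transpose.isOver_left hG' hU)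
  · have := h.left_inv
    rw [hdhat] at this
    rw [← hδ0]
    exact helim.isOver_smul_inv hG hL h.perm h.mem_iff_exists (fun q => (hδ q).2) this
  · have := congrArg Matrix.transpose h.right_inv
    rw [hdhat, Matrix.transpose_mul, Matrix.transpose_mul, Matrix.transpose_add,
      Matrix.transpose_smul, Matrix.transpose_smul, ← LDU.compl_transpose, Matrix.transpose_one,
      ← mul_assoc] at this
    rw [← hδ0]
    refine .of_transpose ?_
    rw [Matrix.transpose_smul]
    exact helim.transpose.isOver_smul_inv hG' hU h.perm.transpose
      (fun i j => (h.mem_iff_exists j i).trans (exists_congr fun q => and_comm))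
      (fun q => (hδ q).2) this
  · rw [← map_ne_zero_iff _ hinj, hnested]
    exact hne q (Nat.lt_succ_iff.mp q.isLt)
  · apply hinj
    rw [hnested, ← ha]
    exact hδ0
  · rw [hnested, hnested]
    exact (hδ q).2
  · rw [hnested]
    exact hδr.symm
  · rw [h.dhat, LDU.ext, LDU.compl_smul ha0, smul_add, smul_smul, mul_comm a]
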